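/- Let $K$ be an algebraically closed field of characteristic zero and let $H$ be a semisimple Hopf algebra over $K$ with coproduct $\Delta$ and counit $\varepsilon$; let $\Lambda\in H$ be the unique two-sided integral with $\varepsilon(\Lambda)=1$. For a natural number $m\ge 1$ and $h\in H$ let $h^{[m]}:=h_{(1)}h_{(2)}\cdots h_{(m)}$ denote the $m$-th Sweedler power of $h$, where $\Delta^m(h)=h_{(1)}\otimes\cdots\otimes h_{(m)}$ is the iterated coproduct. Let $V$ be a finite-dimensional $H$-module with character $\chi$, let $\nu_m(\chi):=\chi(\Lambda^{[m]})\in K$ be its $m$-th Frobenius–Schur indicator, and suppose that $V$ has exponent $d$, i.e. that $d$ is the smallest natural number $m\ge 1$ such that $h^{[m]}.v=\varepsilon(h)v$ for all $h\in H$ and all $v\in V$. Say that $m$ is large compared to $d$ if for every prime $p$ dividing both $d$ and $m$, writing $d=p^kq$ with $p\nmid q$, the power $p^k$ divides $m$. Then: 1. For every natural number $m\ge 1$ that is large compared to $d$, the indicator $\nu_m(\chi)$ is a rational integer. 2. If $d$ is squarefree, then $\nu_m(\chi)$ is a rational integer for every natural number $m\ge 1$. -/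

import Mathlib

open scoped TensorProduct

namespace HopfFS

section Bialgebra

variable (K : Type*) (H : Type*) [Field K] [Ring H] [Bialgebra K H]

/-- The iterated comultiplication `Δⁿ : H → H^{⊗n}`, `h ↦ h₍₁₎ ⊗ h₍₂₎ ⊗ ⋯ ⊗ h₍ₙ₎`: it is the counit
for `n = 0`, and `Δⁿ⁺¹ = (Δⁿ ⊗ id) ∘ Δ`. -/
noncomputable def iterComul : (n : ℕ) → H →ₗ[K] TensorPower K n H
  | 0 => (TensorPower.algebraMap₀ (R := K) (M := H)).toLinearMap ∘ₗ Coalgebra.counit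
  | n + 1 =>
      (TensorPower.mulEquiv (R := K) (M := H) (n := n) (m := 1)).toLinearMap ∘ₗ
        TensorProduct.map (iterComul n)
          (PiTensorProduct.subsingletonEquiv (R := K) (s := fun _ => H) (0 : Fin 1)).symm.toLinearMap ∘ₗ
        Coalgebra.comul

/-- The multiplication map `H^{⊗n} → H`, `x₁ ⊗ ⋯ ⊗ xₙ ↦ x₁ ⋯ xₙ` (in this order). -/
noncomputable def tensorPowerMul (n : ℕ) : TensorPower K n H →ₗ[K] H :=
  PiTensorProduct.lift (MultilinearMap.mkPiAlgebraFin K n H)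

variable {H} in
/-- The `m`-th Sweedler power `h^{[m]} = h₍₁₎ h₍₂₎ ⋯ h₍ₘ₎`. -/
noncomputable def sweedlerPower (m : ℕ) (h : H) : H :=
  tensorPowerMul K H m (iterComul K H m h)

variable {H} in
theorem sweedlerPower_zero (h : H) :
    sweedlerPower K 0 h = algebraMap K H (Coalgebra.counit h) := by
  simp [sweedlerPower, tensorPowerMul, iterComul, TensorPower.algebraMap₀,
    Algebra.algebraMap_eq_smul_one]

theorem tensorPowerMul_mulEquiv (n : ℕ) (x : TensorPower K n H) (y : H) :
    tensorPowerMul K H (n + 1) (TensorPower.mulEquiv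
      (x ⊗ₜ[K] (PiTensorProduct.tprod K fun _ : Fin 1 => y))) =
      tensorPowerMul K H n x * y := by
  induction x using PiTensorProduct.induction_on with
  | smul_tprod r f =>
    rw [← TensorProduct.smul_tmul', map_smul, map_smul, map_smul, smul_mul_assoc]
    congr 1
    change tensorPowerMul K H (n + 1) (@GradedMonoid.GMul.mul ℕ (fun i => TensorPower K i H) _ _ n 1
      (PiTensorProduct.tprod K f) (PiTensorProduct.tprod K fun _ => y)) = _
    rw [TensorPower.tprod_mul_tprod]
    simp only [tensorPowerMul, PiTensorProduct.lift.tprod, MultilinearMap.mkPiAlgebraFin_apply]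
    rw [List.ofFn_fin_append]
    simp
  | add a b ha hb => simp only [TensorProduct.add_tmul, map_add, ha, hb, add_mul]

variable {H} in
theorem sweedlerPower_succ (m : ℕ) (h : H) :
    sweedlerPower K (m + 1) h =
      LinearMap.mul' K H (TensorProduct.map (tensorPowerMul K H m ∘ₗ iterComul K H m)
        LinearMap.id (Coalgebra.comul h)) := by
  simp only [sweedlerPower, iterComul, LinearMap.comp_apply, LinearEquiv.coe_coe]
  induction (Coalgebra.comul (R := K) h) using TensorProduct.induction_on with
  | zero => simp
  | tmul x y => simp [tensorPowerMul_mulEquiv]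
  | add a b ha hb => simp only [map_add, ha, hb]

variable {H} in
/-- A two-sided integral `Λ` of `H` with `ε(Λ) = 1`. -/
structure IsNormalizedIntegral (Λ : H) : Prop where
  mul_left : ∀ h : H, h * Λ = (Coalgebra.counit h : K) • Λ
  mul_right : ∀ h : H, Λ * h = (Coalgebra.counit h : K) • Λ
  counit_eq : (Coalgebra.counit Λ : K) = 1

theorem exists_left_integral {A : Type*} [Ring A] [Algebra K A] [IsSemisimpleRing A]
    (e : A →ₐ[K] K) : ∃ x : A, (∀ h : A, h * x = e h • x) ∧ e x = 1 := by
  obtain ⟨J, hJ⟩ := exists_isCompl (RingHom.ker e : Submodule A A)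
  have h1 : (1 : A) ∈ (RingHom.ker e : Submodule A A) ⊔ J := by rw [hJ.sup_eq_top]; trivial
  obtain ⟨a, ha, b, hb, hab⟩ := Submodule.mem_sup.1 h1
  have ha' : e a = 0 := ha
  have heb : e b = 1 := by
    have := congrArg e hab
    simpa [ha'] using this
  refine ⟨b, fun h => ?_, heb⟩
  have hdiff : h * b - e h • b ∈ (RingHom.ker e : Submodule A A) ⊓ J := by
    refine ⟨?_, J.sub_mem (J.smul_mem h hb) ?_⟩
    · change e (h * b - e h • b) = 0
      rw [map_sub, map_mul, map_smul, smul_eq_mul, sub_self]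
    · rw [← algebraMap_smul A (e h) b]
      exact J.smul_mem _ hb
  rw [hJ.inf_eq_bot] at hdiff
  exact sub_eq_zero.1 hdiff

theorem existsUnique_normalizedIntegral [IsSemisimpleRing H] :
    ∃! Λ : H, IsNormalizedIntegral K Λ := by
  obtain ⟨Λ, h1, h2⟩ := exists_left_integral K (Bialgebra.counitAlgHom K H)
  obtain ⟨M, hM, h2'⟩ := exists_left_integral K ((Bialgebra.counitAlgHom K H).fromOpposite
    fun _ _ => mul_comm _ _)
  obtain ⟨Λ', rfl⟩ := MulOpposite.op_surjective M
  have h1' : ∀ h : H, Λ' * h = (Coalgebra.counit h : K) • Λ' := fun h => by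
    exact congrArg MulOpposite.unop (hM (MulOpposite.op h))
  replace h2 : (Coalgebra.counit Λ : K) = 1 := h2
  replace h2' : (Coalgebra.counit Λ' : K) = 1 := h2'
  replace h1 : ∀ h : H, h * Λ = (Coalgebra.counit h : K) • Λ := h1
  have key : Λ' = Λ := by
    have e1 := h1 Λ'
    have e2 := h1' Λ
    rw [h2', one_smul] at e1
    rw [h2, one_smul] at e2
    exact e2.symm.trans e1
  subst key
  refine ⟨Λ', ⟨h1, h1', h2⟩, fun M hM => ?_⟩
  have e1 := h1 M
  have e2 := hM.mul_right Λ'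
  rw [hM.counit_eq, one_smul] at e1
  rw [h2, one_smul] at e2
  exact e2.symm.trans e1

/-- The unique two-sided integral `Λ ∈ H` with `ε(Λ) = 1` of a semisimple Hopf algebra `H`. -/
noncomputable def normalizedIntegral [IsSemisimpleRing H] : H :=
  (existsUnique_normalizedIntegral K H).exists.choose

theorem normalizedIntegral_spec [IsSemisimpleRing H] :
    IsNormalizedIntegral K (normalizedIntegral K H) :=
  (existsUnique_normalizedIntegral K H).exists.choose_spec

variable (V : Type*) [AddCommGroup V] [Module K V] [Module H V] [IsScalarTower K H V]

/-- The character `χ(h) = tr_V(v ↦ h.v)` of a finite-dimensional `H`-module `V`. -/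
noncomputable def character : H →ₗ[K] K :=
  LinearMap.trace K V ∘ₗ (Algebra.lsmul K K V : H →ₐ[K] Module.End K V).toLinearMap

variable {K H} in
/-- The `m`-th Frobenius–Schur indicator `ν_m(χ) = χ(Λ^{[m]})`. -/
noncomputable def frobeniusSchurIndicator [IsSemisimpleRing H] (m : ℕ) (χ : H →ₗ[K] K) : K :=
  χ (sweedlerPower K m (normalizedIntegral K H))

/-- The exponent of `V`: the smallest `m ≥ 1` such that `h^{[m]}.v = ε(h) v` for all `h ∈ H` and
`v ∈ V`, and `⊤` if there is none. -/
noncomputable def exponent : ℕ∞ :=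
  sInf {n : ℕ∞ | ∃ m : ℕ, n = m ∧ 0 < m ∧
    ∀ (h : H) (v : V), sweedlerPower K m h • v = (Coalgebra.counit h : K) • v}

end Bialgebra

/-- `m` is large compared to `d`: for every prime `p` dividing both `d` and `m`, if `d = p ^ k * q`
with `p ∤ q`, then `p ^ k ∣ m`. -/
def IsLargeComparedTo (m d : ℕ) : Prop :=
  ∀ p : ℕ, p.Prime → p ∣ d → p ∣ m → ∀ k q : ℕ, d = p ^ k * q → ¬ p ∣ q → p ^ k ∣ m

end HopfFS

/-!
The proof evaluates `χ(Λ^{[m]})` in two ways, as a sum of `m`-th roots of unity and, up to the factor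
`dim H`, as a sum of `q`-th roots of unity, where `q = d / gcd(m, d)`. If `m` is large compared to
`d`, then `m` and `q` are coprime, the cyclotomic fields `ℚ(ζ_m)` and `ℚ(ζ_q)` meet in `ℚ`, and a
rational algebraic integer is an integer. If `d` is squarefree, every `m` is large compared to `d`.

Let `π` be the matrix of matrix coefficients of `V`, with entries in the convolution algebra `H*`.
The entries of `π ^ m` are the coefficients of the `m`-th Sweedler powers, so `V` has exponent
dividing `d` exactly when `π ^ d = 1`, and `χ(Λ^{[m]})` is the value of `tr (π ^ m)` at `Λ`.

* The algebra `H*` acts on `H` by `f • x = x₍₁₎ f(x₍₂₎)`, with character `f ↦ (dim H) f(Λ)`. Hence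
  `(dim H) χ(Λ^{[m]})` is the trace of the operator given by `π ^ m`, whose order divides `q`
  (`character_sweedlerPower_mem_adjoin`).
* The integral `Λ` acts on `V^{⊗m}` by the projection onto the invariants, and `χ(Λ^{[m]})` is the
  trace of the rotation of the tensor factors composed with this projection
  (`exists_character_sweedlerPower_eq`). In coordinates the projection is the matrix of values at
  `Λ` of products of `m` entries of `π`. It commutes with the rotation because `Λ` is cocommutative.

Both arguments need the formula for the character of `H*` (`trace_transRight`; cocommutativity of
`Λ` follows from it), and with it the theorem of Larson and Radford that the antipode `S` is an
involution (`antipode_antipode`). It is obtained as follows. The map `f ↦ f(Λ₍₁₎) Λ₍₂₎` from `H*` to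
`H` is onto, since its range is a left ideal containing `S(Λ₍₁₎) Λ₍₂₎ = 1`; in particular `H` is
finite-dimensional and the map is bijective. The preimage `l` of `1` is an integral of `H*`. Its
Nakayama automorphism is given by `S²`, so `S²` fixes the center, and `S⁴` is conjugation by the
group-like element `Λ₍₁₎ l(Λ₍₂₎)` (`antipode_pow_four_mul`), so `S²` has finite order. On each simple
block of `H`, the inverse of `S²` is therefore conjugation by an operator `g` of finite order, and
contributes `tr(g) tr(g⁻¹) ≥ 0` to its trace; the trivial block contributes `1`. So
`l(1) = tr(S⁻²)` is not zero, which forces the group-like element to be `1` and `S⁴ = 1`. Finally, if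
`E` is the idempotent of `H*` given by the regular character divided by `dim H`, the trace of `S²` on
the range of `E` is an integer and equals `tr(S²) / dim H`; as the eigenvalues of `S²` are `±1` and
`S²(1) = 1`, this is possible only if `S² = 1`.
-/

namespace HopfFS

open scoped TensorProduct
open Coalgebra WithConv HopfAlgebra

/-! ### Slices, translations and the convolution product -/

section Slices

variable {K M N : Type*} [Field K] [AddCommGroup M] [Module K M] [AddCommGroup N] [Module K N]

/-- The slice map `x ⊗ y ↦ f(x) y`. -/
noncomputable def sliceLeft (N : Type*) [AddCommGroup N] [Module K N] (f : M →ₗ[K] K) :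
    M ⊗[K] N →ₗ[K] N :=
  (TensorProduct.lid K N).toLinearMap ∘ₗ f.rTensor N

/-- The slice map `x ⊗ y ↦ f(y) x`. -/
noncomputable def sliceRight (M : Type*) [AddCommGroup M] [Module K M] (f : N →ₗ[K] K) :
    M ⊗[K] N →ₗ[K] M :=
  (TensorProduct.rid K M).toLinearMap ∘ₗ f.lTensor M

@[simp] theorem sliceLeft_tmul (f : M →ₗ[K] K) (x : M) (y : N) :
    sliceLeft N f (x ⊗ₜ y) = f x • y := by simp [sliceLeft]

@[simp] theorem sliceRight_tmul (f : N →ₗ[K] K) (x : M) (y : N) :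
    sliceRight M f (x ⊗ₜ y) = f y • x := by simp [sliceRight]

theorem eq_of_forall_dual {x y : M} (h : ∀ f : M →ₗ[K] K, f x = f y) : x = y := by
  rw [← sub_eq_zero, ← Module.forall_dual_apply_eq_zero_iff K]
  intro f
  rw [map_sub, h, sub_self]

/-- A tensor lies in `M ⊗ W` if all its left slices lie in `W`. Here `M ⊗ W` is tested by a linear
map `φ` that sends its generators to a subspace `W'`. -/
theorem map_mem_of_forall_sliceLeft_mem {P : Type*} [AddCommGroup P] [Module K P]
    (φ : M ⊗[K] N →ₗ[K] P) (W : Submodule K N) (W' : Submodule K P)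
    (hφ : ∀ x, ∀ y ∈ W, φ (x ⊗ₜ y) ∈ W') (t : M ⊗[K] N)
    (ht : ∀ f : M →ₗ[K] K, sliceLeft N f t ∈ W) : φ t ∈ W' := by
  classical
  let b := Module.Basis.ofVectorSpace K M
  have key : ∀ (t : M ⊗[K] N) i, (TensorProduct.equivFinsuppOfBasisLeft (N := N) b t) i =
      sliceLeft N (b.coord i) t := by
    intro t i
    induction t using TensorProduct.induction_on with
    | zero => simp
    | tmul x y => simp
    | add x y hx hy => simp only [map_add, Finsupp.add_apply, hx, hy]
  rw [← (TensorProduct.equivFinsuppOfBasisLeft (N := N) b).symm_apply_apply t,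
    TensorProduct.equivFinsuppOfBasisLeft_symm_apply, Finsupp.sum, map_sum]
  refine W'.sum_mem fun i _ => hφ _ _ ?_
  rw [key]
  exact ht _

theorem tensor_eq_of_forall_dual {s t : M ⊗[K] N}
    (h : ∀ (f : M →ₗ[K] K) (g : N →ₗ[K] K), g (sliceLeft N f s) = g (sliceLeft N f t)) :
    s = t := by
  have := map_mem_of_forall_sliceLeft_mem (LinearMap.id : M ⊗[K] N →ₗ[K] M ⊗[K] N) ⊥ ⊥
    (by rintro x y hy; rw [Submodule.mem_bot] at hy; simp [hy]) (s - t) (fun f => by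
      rw [Submodule.mem_bot, map_sub, sub_eq_zero]
      exact eq_of_forall_dual (h f))
  simpa [sub_eq_zero] using this

theorem exists_finite_forall_sliceLeft_mem (t : M ⊗[K] N) :
    ∃ W : Submodule K N, FiniteDimensional K W ∧ ∀ f : M →ₗ[K] K, sliceLeft N f t ∈ W := by
  induction t using TensorProduct.induction_on with
  | zero => exact ⟨⊥, inferInstance, by simp⟩
  | tmul x y =>
    refine ⟨K ∙ y, inferInstance, fun f => ?_⟩
    rw [sliceLeft_tmul]
    exact Submodule.smul_mem _ _ (Submodule.mem_span_singleton_self y)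
  | add s t hs ht =>
    obtain ⟨W, _, hW⟩ := hs
    obtain ⟨W', _, hW'⟩ := ht
    refine ⟨W ⊔ W', inferInstance, fun f => ?_⟩
    rw [map_add]
    exact Submodule.add_mem_sup (hW f) (hW' f)

end Slices

section Algebra

variable {K H : Type*} [Field K] [Ring H] [Algebra K H]

theorem sliceLeft_one_tmul_mul (f : H →ₗ[K] K) (h : H) (t : H ⊗[K] H) :
    sliceLeft H f (((1 : H) ⊗ₜ[K] h) * t) = h * sliceLeft H f t := by
  induction t using TensorProduct.induction_on with
  | zero => simp
  | tmul x y => simp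
  | add s t hs ht => rw [mul_add, map_add, hs, ht, map_add, mul_add]

theorem sliceLeft_mul_one_tmul (f : H →ₗ[K] K) (h : H) (t : H ⊗[K] H) :
    sliceLeft H f (t * ((1 : H) ⊗ₜ[K] h)) = sliceLeft H f t * h := by
  induction t using TensorProduct.induction_on with
  | zero => simp
  | tmul x y => simp
  | add s t hs ht => rw [add_mul, map_add, hs, ht, map_add, add_mul]

theorem sliceLeft_tmul_one_mul (f : H →ₗ[K] K) (h : H) (t : H ⊗[K] H) :
    sliceLeft H f ((h ⊗ₜ[K] (1 : H)) * t) = sliceLeft H (f ∘ₗ LinearMap.mulLeft K h) t := by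
  induction t using TensorProduct.induction_on with
  | zero => simp
  | tmul x y => simp
  | add s t hs ht => rw [mul_add, map_add, hs, ht, map_add]

theorem sliceLeft_mul_tmul_one (f : H →ₗ[K] K) (h : H) (t : H ⊗[K] H) :
    sliceLeft H f (t * (h ⊗ₜ[K] (1 : H))) = sliceLeft H (f ∘ₗ LinearMap.mulRight K h) t := by
  induction t using TensorProduct.induction_on with
  | zero => simp
  | tmul x y => simp
  | add s t hs ht => rw [add_mul, map_add, hs, ht, map_add]

theorem sliceRight_tmul_one_mul (f : H →ₗ[K] K) (h : H) (t : H ⊗[K] H) :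
    sliceRight H f ((h ⊗ₜ[K] (1 : H)) * t) = h * sliceRight H f t := by
  induction t using TensorProduct.induction_on with
  | zero => simp
  | tmul x y => simp
  | add s t hs ht => rw [mul_add, map_add, hs, ht, map_add, mul_add]

theorem sliceRight_mul_tmul_one (f : H →ₗ[K] K) (h : H) (t : H ⊗[K] H) :
    sliceRight H f (t * (h ⊗ₜ[K] (1 : H))) = sliceRight H f t * h := by
  induction t using TensorProduct.induction_on with
  | zero => simp
  | tmul x y => simp
  | add s t hs ht => rw [add_mul, map_add, hs, ht, map_add, add_mul]

theorem sliceRight_one_tmul_mul (f : H →ₗ[K] K) (h : H) (t : H ⊗[K] H) :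
    sliceRight H f (((1 : H) ⊗ₜ[K] h) * t) = sliceRight H (f ∘ₗ LinearMap.mulLeft K h) t := by
  induction t using TensorProduct.induction_on with
  | zero => simp
  | tmul x y => simp
  | add s t hs ht => rw [mul_add, map_add, hs, ht, map_add]

theorem sliceRight_mul_one_tmul (f : H →ₗ[K] K) (h : H) (t : H ⊗[K] H) :
    sliceRight H f (t * ((1 : H) ⊗ₜ[K] h)) = sliceRight H (f ∘ₗ LinearMap.mulRight K h) t := by
  induction t using TensorProduct.induction_on with
  | zero => simp
  | tmul x y => simp
  | add s t hs ht => rw [add_mul, map_add, hs, ht, map_add]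

end Algebra

section Translation

variable {K H : Type*} [Field K] [Ring H] [Bialgebra K H]

/-- The translation `x ↦ f(x₍₁₎) x₍₂₎`. -/
noncomputable def transLeft (f : H →ₗ[K] K) : H →ₗ[K] H := sliceLeft H f ∘ₗ comul

/-- The translation `x ↦ x₍₁₎ f(x₍₂₎)`. -/
noncomputable def transRight (f : H →ₗ[K] K) : H →ₗ[K] H := sliceRight H f ∘ₗ comul

/-- The convolution product of linear forms, `(f * g)(x) = f(x₍₁₎) g(x₍₂₎)`. -/
noncomputable def conv (f g : H →ₗ[K] K) : H →ₗ[K] K := (toConv f * toConv g).ofConv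

theorem conv_apply (f g : H →ₗ[K] K) (x : H) :
    conv f g x = LinearMap.mul' K K (TensorProduct.map f g (comul x)) := rfl

theorem conv_assoc (f g k : H →ₗ[K] K) : conv (conv f g) k = conv f (conv g k) :=
  congrArg ofConv (mul_assoc (toConv f) (toConv g) (toConv k))

theorem conv_counit (f : H →ₗ[K] K) : conv f counit = f :=
  congrArg ofConv (mul_one (toConv f))

theorem counit_conv (f : H →ₗ[K] K) : conv counit f = f :=
  congrArg ofConv (one_mul (toConv f))

theorem apply_sliceLeft {M N : Type*} [AddCommGroup M] [Module K M] [AddCommGroup N] [Module K N]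
    (f : M →ₗ[K] K) (g : N →ₗ[K] K) (t : M ⊗[K] N) :
    g (sliceLeft N f t) = LinearMap.mul' K K (TensorProduct.map f g t) := by
  induction t using TensorProduct.induction_on with
  | zero => simp
  | tmul x y => simp
  | add s t hs ht => simp only [map_add, hs, ht]

theorem apply_sliceRight {M N : Type*} [AddCommGroup M] [Module K M] [AddCommGroup N] [Module K N]
    (f : M →ₗ[K] K) (g : N →ₗ[K] K) (t : M ⊗[K] N) :
    f (sliceRight M g t) = LinearMap.mul' K K (TensorProduct.map f g t) := by
  induction t using TensorProduct.induction_on with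
  | zero => simp
  | tmul x y => simp [mul_comm]
  | add s t hs ht => simp only [map_add, hs, ht]

theorem apply_transLeft (f g : H →ₗ[K] K) (x : H) : g (transLeft f x) = conv f g x :=
  apply_sliceLeft _ _ _

theorem apply_transRight (f g : H →ₗ[K] K) (x : H) : f (transRight g x) = conv f g x :=
  apply_sliceRight _ _ _

theorem transLeft_transLeft (f g : H →ₗ[K] K) (x : H) :
    transLeft g (transLeft f x) = transLeft (conv f g) x :=
  eq_of_forall_dual (K := K) fun k => by simp only [apply_transLeft, conv_assoc]

theorem transRight_transRight (f g : H →ₗ[K] K) (x : H) :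
    transRight f (transRight g x) = transRight (conv f g) x :=
  eq_of_forall_dual (K := K) fun k => by simp only [apply_transRight, conv_assoc]

theorem transLeft_one (f : H →ₗ[K] K) : transLeft f (1 : H) = f 1 • 1 := by
  simp [transLeft, Algebra.TensorProduct.one_def]

theorem counit_transLeft (f : H →ₗ[K] K) (x : H) : counit (R := K) (transLeft f x) = f x := by
  rw [apply_transLeft, conv_counit]

theorem counit_transRight (f : H →ₗ[K] K) (x : H) : counit (R := K) (transRight f x) = f x := by
  rw [apply_transRight, counit_conv]

theorem transRight_counit (x : H) : transRight (counit : H →ₗ[K] K) x = x :=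
  eq_of_forall_dual (K := K) fun k => by rw [apply_transRight, conv_counit]

/-- Coassociativity, contracted with `f` in the last tensor factor. -/
theorem lTensor_transRight_comul (f : H →ₗ[K] K) (x : H) :
    (transRight f).lTensor H (comul x) = comul (R := K) (transRight f x) := by
  apply tensor_eq_of_forall_dual
  intro k l
  have h1 : ∀ t : H ⊗[K] H, l (sliceLeft H k ((transRight f).lTensor H t)) =
      LinearMap.mul' K K (TensorProduct.map k (conv l f) t) := by
    intro t
    induction t using TensorProduct.induction_on with
    | zero => simp
    | tmul x y => simp [apply_transRight]
    | add s t hs ht => simp only [map_add, hs, ht]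
  rw [h1, ← conv_apply, ← conv_assoc, apply_sliceLeft, ← conv_apply, apply_transRight]

end Translation

/-! ### The antipode and the integral -/

section Antipode

variable {K H : Type*} [Field K] [Ring H] [HopfAlgebra K H]

/-- The embedding `h ↦ h ⊗ 1`, as an element of the convolution algebra `Hom(H, H ⊗ H)`. -/
noncomputable def convInclLeft (K H : Type*) [Field K] [Ring H] [HopfAlgebra K H] :
    WithConv (H →ₗ[K] H ⊗[K] H) :=
  toConv (Algebra.TensorProduct.includeLeft : H →ₐ[K] H ⊗[K] H).toLinearMap

/-- The embedding `h ↦ 1 ⊗ h`, as an element of the convolution algebra `Hom(H, H ⊗ H)`. -/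
noncomputable def convInclRight (K H : Type*) [Field K] [Ring H] [HopfAlgebra K H] :
    WithConv (H →ₗ[K] H ⊗[K] H) :=
  toConv (Algebra.TensorProduct.includeRight : H →ₐ[K] H ⊗[K] H).toLinearMap

/-- The convolution inverse `h ↦ S(h) ⊗ 1` of `convInclLeft`. -/
noncomputable def convInclLeftInv (K H : Type*) [Field K] [Ring H] [HopfAlgebra K H] :
    WithConv (H →ₗ[K] H ⊗[K] H) :=
  toConv ((Algebra.TensorProduct.includeLeft : H →ₐ[K] H ⊗[K] H).toLinearMap ∘ₗ antipode K)

/-- The convolution inverse `h ↦ 1 ⊗ S(h)` of `convInclRight`. -/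
noncomputable def convInclRightInv (K H : Type*) [Field K] [Ring H] [HopfAlgebra K H] :
    WithConv (H →ₗ[K] H ⊗[K] H) :=
  toConv ((Algebra.TensorProduct.includeRight : H →ₐ[K] H ⊗[K] H).toLinearMap ∘ₗ antipode K)

theorem algHom_comp_convOne {B : Type*} [Ring B] [Algebra K B] (φ : H →ₐ[K] B) :
    toConv (φ.toLinearMap ∘ₗ (1 : WithConv (H →ₗ[K] H)).ofConv) = 1 := by
  apply WithConv.ext
  ext x
  simp [LinearMap.convOne_def]

theorem convInclLeftInv_mul : convInclLeftInv K H * convInclLeft K H = 1 := by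
  have := LinearMap.algHom_comp_convMul_distrib
    (Algebra.TensorProduct.includeLeft : H →ₐ[K] H ⊗[K] H) (toConv (antipode K)) (toConv .id)
  rw [LinearMap.antipode_mul_id] at this
  exact (congrArg toConv this).symm.trans (algHom_comp_convOne _)

theorem convInclRight_mul_inv : convInclRight K H * convInclRightInv K H = 1 := by
  have := LinearMap.algHom_comp_convMul_distrib
    (Algebra.TensorProduct.includeRight : H →ₐ[K] H ⊗[K] H) (toConv .id) (toConv (antipode K))
  rw [LinearMap.id_mul_antipode] at this
  exact (congrArg toConv this).symm.trans (algHom_comp_convOne _)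

theorem convInclRightInv_mul : convInclRightInv K H * convInclRight K H = 1 := by
  have := LinearMap.algHom_comp_convMul_distrib
    (Algebra.TensorProduct.includeRight : H →ₐ[K] H ⊗[K] H) (toConv (antipode K)) (toConv .id)
  rw [LinearMap.antipode_mul_id] at this
  exact (congrArg toConv this).symm.trans (algHom_comp_convOne _)

theorem convInclLeft_mul_convInclRight :
    convInclLeft K H * convInclRight K H = toConv comul := by
  apply WithConv.ext
  ext x
  change LinearMap.mul' K _ (TensorProduct.map (convInclLeft K H).ofConv (convInclRight K H).ofConv
    (comul x)) = comul x
  induction (comul (R := K) x) using TensorProduct.induction_on with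
  | zero => simp
  | tmul x y => simp [convInclLeft, convInclRight]
  | add s t hs ht => rw [map_add, map_add, hs, ht]

/-- The antipode is an anti-coalgebra map: `Δ(S(x)) = S(x₍₂₎) ⊗ S(x₍₁₎)`. Both sides are the
convolution inverse of `Δ(x) = (x₍₁₎ ⊗ 1)(1 ⊗ x₍₂₎)`. -/
theorem convInclRightInv_mul_convInclLeftInv :
    convInclRightInv K H * convInclLeftInv K H = toConv (comul ∘ₗ antipode K) := by
  refine left_inv_eq_right_inv (a := toConv comul) ?_ LinearMap.comul_right_inv
  rw [← convInclLeft_mul_convInclRight, mul_assoc, ← mul_assoc (convInclLeftInv K H),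
    convInclLeftInv_mul, one_mul, convInclRightInv_mul]

theorem conv_apply_antipode (f g : H →ₗ[K] K) (x : H) :
    conv f g (antipode K x) = conv (g ∘ₗ antipode K) (f ∘ₗ antipode K) x := by
  have h := congrArg (fun φ => φ.ofConv x) (convInclRightInv_mul_convInclLeftInv (K := K) (H := H))
  change LinearMap.mul' K _ (TensorProduct.map (convInclRightInv K H).ofConv
    (convInclLeftInv K H).ofConv (comul x)) = comul (antipode K x) at h
  rw [conv_apply, conv_apply, ← h]
  induction (comul (R := K) x) using TensorProduct.induction_on with
  | zero => simp
  | tmul x y => simp [convInclLeftInv, convInclRightInv, mul_comm]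
  | add s t hs ht => simp only [map_add, hs, ht]

theorem antipode_transRight (f : H →ₗ[K] K) (x : H) :
    antipode K (transRight (f ∘ₗ antipode K) x) = transLeft f (antipode K x) :=
  eq_of_forall_dual (K := K) fun k => by
    rw [apply_transLeft, conv_apply_antipode, ← apply_transRight]; rfl

theorem antipode_transLeft (f : H →ₗ[K] K) (x : H) :
    antipode K (transLeft (f ∘ₗ antipode K) x) = transRight f (antipode K x) :=
  eq_of_forall_dual (K := K) fun k => by
    rw [apply_transRight, conv_apply_antipode, ← apply_transLeft]; rfl

end Antipode

section Integral

variable {K H : Type*} [Field K] [Ring H] [HopfAlgebra K H] {Λ : H}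

namespace IsNormalizedIntegral

theorem comul_mul_comul (hΛ : IsNormalizedIntegral K Λ) (h : H) :
    comul (R := K) h * comul Λ = (counit h : K) • comul Λ := by
  rw [← Bialgebra.comul_mul, hΛ.mul_left, map_smul]

theorem comul_mul_comul' (hΛ : IsNormalizedIntegral K Λ) (h : H) :
    comul (R := K) Λ * comul h = (counit h : K) • comul Λ := by
  rw [← Bialgebra.comul_mul, hΛ.mul_right, map_smul]

/-- `Λ₍₁₎ ⊗ h Λ₍₂₎ = S(h) Λ₍₁₎ ⊗ Λ₍₂₎`. -/
theorem one_tmul_mul_comul (hΛ : IsNormalizedIntegral K Λ) (h : H) :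
    ((1 : H) ⊗ₜ[K] h) * comul Λ = (antipode K h ⊗ₜ[K] (1 : H)) * comul Λ := by
  have h1 : convInclLeftInv K H * toConv comul = convInclRight K H := by
    rw [← convInclLeft_mul_convInclRight, ← mul_assoc, convInclLeftInv_mul, one_mul]
  have h2 : ((1 : H) ⊗ₜ[K] h) = LinearMap.mul' K _
      (TensorProduct.map (convInclLeftInv K H).ofConv comul (comul h)) :=
    (congrArg (fun φ => φ.ofConv h) h1).symm
  have h3 : (antipode K h ⊗ₜ[K] (1 : H)) = LinearMap.mul' K _
      (TensorProduct.map (convInclLeftInv K H).ofConv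
        (1 : WithConv (H →ₗ[K] H ⊗[K] H)).ofConv (comul h)) :=
    (congrArg (fun φ => φ.ofConv h) (mul_one (convInclLeftInv K H))).symm
  rw [h2, h3]
  induction (comul (R := K) h) using TensorProduct.induction_on with
  | zero => simp
  | tmul x y =>
    simp only [TensorProduct.map_tmul, LinearMap.mul'_apply, mul_assoc, hΛ.comul_mul_comul,
      LinearMap.convOne_def, LinearMap.comp_apply, Algebra.linearMap_apply, ← Algebra.smul_def]
  | add s t hs ht => simp only [map_add, hs, ht, add_mul]

/-- `Λ₍₁₎ h ⊗ Λ₍₂₎ = Λ₍₁₎ ⊗ Λ₍₂₎ S(h)`. -/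
theorem comul_mul_tmul_one (hΛ : IsNormalizedIntegral K Λ) (h : H) :
    comul Λ * (h ⊗ₜ[K] (1 : H)) = comul Λ * ((1 : H) ⊗ₜ[K] antipode K h) := by
  have h1 : toConv comul * convInclRightInv K H = convInclLeft K H := by
    rw [← convInclLeft_mul_convInclRight, mul_assoc, convInclRight_mul_inv, mul_one]
  have h2 : (h ⊗ₜ[K] (1 : H)) = LinearMap.mul' K _
      (TensorProduct.map comul (convInclRightInv K H).ofConv (comul h)) :=
    (congrArg (fun φ => φ.ofConv h) h1).symm
  have h3 : ((1 : H) ⊗ₜ[K] antipode K h) = LinearMap.mul' K _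
      (TensorProduct.map (1 : WithConv (H →ₗ[K] H ⊗[K] H)).ofConv
        (convInclRightInv K H).ofConv (comul h)) :=
    (congrArg (fun φ => φ.ofConv h) (one_mul (convInclRightInv K H))).symm
  rw [h2, h3]
  induction (comul (R := K) h) using TensorProduct.induction_on with
  | zero => simp
  | tmul x y =>
    simp only [TensorProduct.map_tmul, LinearMap.mul'_apply, ← mul_assoc, hΛ.comul_mul_comul',
      LinearMap.convOne_def, LinearMap.comp_apply, Algebra.linearMap_apply]
    rw [← Algebra.commutes, ← Algebra.smul_def]
  | add s t hs ht => simp only [map_add, hs, ht, mul_add]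

theorem mul_transLeft (hΛ : IsNormalizedIntegral K Λ) (f : H →ₗ[K] K) (h : H) :
    h * transLeft f Λ = transLeft (f ∘ₗ LinearMap.mulLeft K (antipode K h)) Λ := by
  simp only [transLeft, LinearMap.comp_apply]
  rw [← sliceLeft_one_tmul_mul, hΛ.one_tmul_mul_comul, sliceLeft_tmul_one_mul]

theorem transLeft_mul_antipode (hΛ : IsNormalizedIntegral K Λ) (f : H →ₗ[K] K) (h : H) :
    transLeft f Λ * antipode K h = transLeft (f ∘ₗ LinearMap.mulRight K h) Λ := by
  simp only [transLeft, LinearMap.comp_apply]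
  rw [← sliceLeft_mul_one_tmul, ← hΛ.comul_mul_tmul_one, sliceLeft_mul_tmul_one]

theorem antipode_mul_transRight (hΛ : IsNormalizedIntegral K Λ) (f : H →ₗ[K] K) (h : H) :
    antipode K h * transRight f Λ = transRight (f ∘ₗ LinearMap.mulLeft K h) Λ := by
  simp only [transRight, LinearMap.comp_apply]
  rw [← sliceRight_one_tmul_mul, hΛ.one_tmul_mul_comul, sliceRight_tmul_one_mul]

theorem transRight_mul (hΛ : IsNormalizedIntegral K Λ) (f : H →ₗ[K] K) (h : H) :
    transRight f Λ * h = transRight (f ∘ₗ LinearMap.mulRight K (antipode K h)) Λ := by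
  simp only [transRight, LinearMap.comp_apply]
  rw [← sliceRight_mul_tmul_one, hΛ.comul_mul_tmul_one, sliceRight_mul_one_tmul]

/-- The map `f ↦ f(Λ₍₁₎) Λ₍₂₎` from the dual of `H` to `H`. -/
noncomputable def fourier (K : Type*) {H : Type*} [Field K] [Ring H] [HopfAlgebra K H] (Λ : H) :
    (H →ₗ[K] K) →ₗ[K] H where
  toFun f := transLeft f Λ
  map_add' f g := eq_of_forall_dual (K := K) fun k => by
    rw [map_add]; simp only [apply_transLeft, conv_apply, TensorProduct.map_add_left,
      LinearMap.add_apply, map_add]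
  map_smul' c f := eq_of_forall_dual (K := K) fun k => by
    rw [map_smul]; simp only [apply_transLeft, conv_apply, TensorProduct.map_smul_left,
      LinearMap.smul_apply, map_smul, RingHom.id_apply]

theorem fourier_apply (f : H →ₗ[K] K) : fourier K Λ f = transLeft f Λ := rfl

/-- The range of `f ↦ f(Λ₍₁₎) Λ₍₂₎` is a left ideal, and it contains `S(Λ₍₁₎) Λ₍₂₎ = 1`. -/
theorem fourier_surjective (hΛ : IsNormalizedIntegral K Λ) :
    Function.Surjective (fourier K Λ) := by
  have hideal : ∀ h y, y ∈ LinearMap.range (fourier K Λ) →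
      h * y ∈ LinearMap.range (fourier K Λ) := by
    rintro h _ ⟨f, rfl⟩
    exact ⟨_, (hΛ.mul_transLeft f h).symm⟩
  have h1 : (1 : H) ∈ LinearMap.range (fourier K Λ) := by
    have h2 := mul_antipode_rTensor_comul_apply (R := K) Λ
    rw [hΛ.counit_eq, map_one] at h2
    rw [← h2]
    refine map_mem_of_forall_sliceLeft_mem
      (LinearMap.mul' K H ∘ₗ (antipode K).rTensor H) (LinearMap.range (fourier K Λ)) _ ?_ _
      fun f => ⟨f, rfl⟩
    intro x y hy
    simpa using hideal _ _ hy
  intro h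
  simpa using hideal h 1 h1

/-- A Hopf algebra with a normalized integral is finite-dimensional. -/
theorem finiteDimensional (hΛ : IsNormalizedIntegral K Λ) : FiniteDimensional K H := by
  obtain ⟨W, hW, h⟩ := exists_finite_forall_sliceLeft_mem (comul (R := K) Λ)
  have : W = ⊤ := by
    rw [eq_top_iff]
    intro x _
    obtain ⟨f, rfl⟩ := hΛ.fourier_surjective x
    exact h f
  subst this
  exact Module.Finite.equiv (Submodule.topEquiv (R := K) (M := H))

theorem fourier_injective (hΛ : IsNormalizedIntegral K Λ) :
    Function.Injective (fourier K Λ) := by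
  have := hΛ.finiteDimensional
  refine (LinearMap.injective_iff_surjective_of_finrank_eq_finrank ?_).2 hΛ.fourier_surjective
  exact Subspace.dual_finrank_eq

theorem antipode_injective (hΛ : IsNormalizedIntegral K Λ) :
    Function.Injective (antipode K (A := H)) := by
  rw [← LinearMap.ker_eq_bot, LinearMap.ker_eq_bot']
  intro h hh
  obtain ⟨f, hf⟩ := hΛ.fourier_surjective 1
  have := hΛ.mul_transLeft f h
  rw [← fourier_apply, hf, hh, mul_one] at this
  rw [this, ← fourier_apply]
  simp

theorem antipode_bijective (hΛ : IsNormalizedIntegral K Λ) :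
    Function.Bijective (antipode K (A := H)) := by
  have := hΛ.finiteDimensional
  exact ⟨hΛ.antipode_injective, LinearMap.injective_iff_surjective.1 hΛ.antipode_injective⟩

end IsNormalizedIntegral

end Integral

/-! ### The integral of the dual and Radford's formula -/

section DualIntegral

variable {K H : Type*} [Field K] [Ring H] [HopfAlgebra K H] {Λ : H}

namespace IsNormalizedIntegral

/-- There is a linear form `l` with `l(Λ₍₁₎) Λ₍₂₎ = 1`; it is a right integral of the dual. -/
theorem exists_transLeft_eq_one (hΛ : IsNormalizedIntegral K Λ) :
    ∃ l : H →ₗ[K] K, transLeft l Λ = 1 :=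
  hΛ.fourier_surjective 1

variable {l : H →ₗ[K] K}

theorem transLeft_mulLeft_antipode (hΛ : IsNormalizedIntegral K Λ) (hl : transLeft l Λ = 1)
    (h : H) : transLeft (l ∘ₗ LinearMap.mulLeft K (antipode K h)) Λ = h := by
  rw [← hΛ.mul_transLeft, hl, mul_one]

theorem transLeft_mulRight (hΛ : IsNormalizedIntegral K Λ) (hl : transLeft l Λ = 1)
    (h : H) : transLeft (l ∘ₗ LinearMap.mulRight K h) Λ = antipode K h := by
  rw [← hΛ.transLeft_mul_antipode, hl, one_mul]

/-- The square of the antipode is the Nakayama automorphism of `l`. -/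
theorem comp_mulLeft_antipode_antipode (hΛ : IsNormalizedIntegral K Λ)
    (hl : transLeft l Λ = 1) (h : H) :
    l ∘ₗ LinearMap.mulLeft K (antipode K (antipode K h)) = l ∘ₗ LinearMap.mulRight K h := by
  apply hΛ.fourier_injective
  rw [fourier_apply, fourier_apply, hΛ.transLeft_mulLeft_antipode hl, hΛ.transLeft_mulRight hl]

theorem antipode_antipode_of_mem_center (hΛ : IsNormalizedIntegral K Λ)
    {z : H} (hz : ∀ x, z * x = x * z) : antipode K (antipode K z) = z := by
  obtain ⟨l, hl⟩ := hΛ.exists_transLeft_eq_one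
  have h1 : LinearMap.mulRight K z = LinearMap.mulLeft K z := by
    ext x; simp [hz]
  have h2 := hΛ.comp_mulLeft_antipode_antipode hl z
  obtain ⟨u, rfl⟩ := hΛ.antipode_bijective.2 z
  rw [h1] at h2
  have h3 := congrArg (fun f => transLeft f Λ) h2
  simp only [hΛ.transLeft_mulLeft_antipode hl] at h3
  rw [h3]

theorem conv_left_eq (hΛ : IsNormalizedIntegral K Λ) (hl : transLeft l Λ = 1)
    (g : H →ₗ[K] K) : conv l g = g 1 • l := by
  apply hΛ.fourier_injective
  rw [map_smul, fourier_apply, fourier_apply, ← transLeft_transLeft, hl, transLeft_one]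

/-- The product `f * l` is again a right integral of the dual, so it is a multiple of `l`; the factor
is the value of `f` at `Λ₍₁₎ l(Λ₍₂₎)`. -/
theorem conv_right_eq (hΛ : IsNormalizedIntegral K Λ) (hl : transLeft l Λ = 1)
    (f : H →ₗ[K] K) : conv f l = f (transRight l Λ) • l := by
  set y := transLeft (conv f l) Λ with hy
  have h1 : ∀ g : H →ₗ[K] K, g y = g (counit (R := K) y • 1) := by
    intro g
    rw [← counit_transLeft g y, hy, transLeft_transLeft, conv_assoc, hΛ.conv_left_eq hl]
    have : conv f (g 1 • l) = g 1 • conv f l := by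
      ext x
      simp only [← apply_transLeft, LinearMap.smul_apply]
    rw [this, ← fourier_apply, map_smul, map_smul, map_smul, fourier_apply, ← hy]
    simp [mul_comm]
  apply hΛ.fourier_injective
  rw [map_smul, fourier_apply, fourier_apply, hl, ← hy, eq_of_forall_dual h1, hy,
    counit_transLeft, apply_transRight]

theorem apply_eq_one_of_transLeft_eq_one (hl : transLeft l Λ = 1) :
    l Λ = 1 := by
  rw [← counit_transLeft l Λ, hl, Bialgebra.counit_one]

theorem isGroupLikeElem_transRight (hΛ : IsNormalizedIntegral K Λ) (hl : transLeft l Λ = 1) :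
    IsGroupLikeElem K (transRight l Λ) where
  counit_eq_one := by rw [counit_transRight, apply_eq_one_of_transLeft_eq_one hl]
  comul_eq_tmul_self := by
    apply tensor_eq_of_forall_dual
    intro f g
    have h1 : conv (conv f g) l Λ = conv f (conv g l) Λ := by rw [conv_assoc]
    rw [hΛ.conv_right_eq hl, hΛ.conv_right_eq hl] at h1
    have h2 : conv f (g (transRight l Λ) • l) = g (transRight l Λ) • conv f l := by
      ext x
      simp only [← apply_transLeft, LinearMap.smul_apply]
    rw [h2, hΛ.conv_right_eq hl] at h1
    simp only [LinearMap.smul_apply, apply_eq_one_of_transLeft_eq_one hl, smul_eq_mul, mul_one] at h1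
    rw [apply_sliceLeft, ← conv_apply, h1]
    simp [mul_comm]

/-- Radford's formula: the fourth power of the antipode is conjugation by a group-like element. -/
theorem antipode_pow_four_mul (hΛ : IsNormalizedIntegral K Λ) (hl : transLeft l Λ = 1) (h : H) :
    antipode K (antipode K (antipode K (antipode K h))) * transRight l Λ =
      transRight l Λ * h := by
  rw [hΛ.antipode_mul_transRight, hΛ.comp_mulLeft_antipode_antipode hl, ← hΛ.transRight_mul]

/-- A group-like element of a finite-dimensional Hopf algebra has finite order, because distinct
group-like elements are linearly independent. -/
theorem exists_pow_eq_one_of_isGroupLikeElem [FiniteDimensional K H] {a : H}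
    (ha : IsGroupLikeElem K a) : ∃ N : ℕ, 0 < N ∧ a ^ N = 1 := by
  have hfin : Finite (GroupLike K H) := (linearIndep_groupLikeVal (R := K) (A := H)).finite
  have h := isOfFinOrder_of_finite (⟨a, ha⟩ : GroupLike K H)
  obtain ⟨N, hN, h⟩ := isOfFinOrder_iff_pow_eq_one.1 h
  exact ⟨N, hN, by simpa using congrArg GroupLike.val h⟩

end IsNormalizedIntegral

/-- The square of the antipode, as an algebra endomorphism. -/
noncomputable def antipodeSq (K H : Type*) [Field K] [Ring H] [HopfAlgebra K H] : H →ₐ[K] H :=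
  AlgHom.ofLinearMap (antipode K ∘ₗ antipode K) (by simp)
    (fun x y => by simp [antipode_mul_antidistrib])

theorem antipodeSq_apply (h : H) : antipodeSq K H h = antipode K (antipode K h) := rfl

namespace IsNormalizedIntegral

theorem exists_antipodeSq_pow_eq_one (hΛ : IsNormalizedIntegral K Λ) :
    ∃ M : ℕ, 0 < M ∧ antipodeSq K H ^ M = 1 := by
  have := hΛ.finiteDimensional
  obtain ⟨l, hl⟩ := hΛ.exists_transLeft_eq_one
  have ha := hΛ.isGroupLikeElem_transRight hl
  set a := transRight l Λ with ha'
  have h1 : ∀ h, (antipodeSq K H ^ 2) h * a = a * h := fun h => hΛ.antipode_pow_four_mul hl h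
  have h2 : ∀ (N : ℕ) (h : H), (antipodeSq K H ^ (2 * N)) h * a ^ N = a ^ N * h := by
    intro N
    induction N with
    | zero => simp
    | succ N ih =>
      intro h
      have : (antipodeSq K H ^ (2 * (N + 1))) h =
          (antipodeSq K H ^ 2) ((antipodeSq K H ^ (2 * N)) h) := by
        rw [← AlgHom.mul_apply, ← pow_add]; congr 2; ring
      rw [this, pow_succ' a N, ← mul_assoc, h1, mul_assoc, ih, mul_assoc]
  obtain ⟨N, hN, haN⟩ := exists_pow_eq_one_of_isGroupLikeElem ha
  refine ⟨2 * N, by omega, AlgHom.ext fun h => ?_⟩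
  have := h2 N h
  rwa [haN, mul_one, one_mul] at this

/-- The antipode as a linear automorphism. -/
noncomputable def antipodeEquiv (hΛ : IsNormalizedIntegral K Λ) : H ≃ₗ[K] H :=
  LinearEquiv.ofBijective (antipode K) hΛ.antipode_bijective

@[simp] theorem antipodeEquiv_apply (hΛ : IsNormalizedIntegral K Λ) (h : H) :
    hΛ.antipodeEquiv h = antipode K h := rfl

end IsNormalizedIntegral

/-- The operator `x ↦ l(x a) b` attached to the tensor `a ⊗ b`. -/
noncomputable def tensorOperator (l : H →ₗ[K] K) : H ⊗[K] H →ₗ[K] Module.End K H :=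
  TensorProduct.lift (LinearMap.mk₂ K
    (fun a b => LinearMap.smulRight (l ∘ₗ LinearMap.mulRight K a) b)
    (fun a a' b => by ext x; simp [mul_add, add_smul])
    (fun c a b => by ext x; simp [mul_smul])
    (fun a b b' => by ext x; simp)
    (fun c a b => by ext x; exact smul_comm _ _ _))

theorem tensorOperator_apply (l : H →ₗ[K] K) (t : H ⊗[K] H) (x : H) :
    tensorOperator l t x = sliceLeft H (l ∘ₗ LinearMap.mulLeft K x) t := by
  induction t using TensorProduct.induction_on with
  | zero => simp
  | tmul a b => simp [tensorOperator]
  | add s t hs ht => simp only [map_add, LinearMap.add_apply, hs, ht]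

theorem trace_tensorOperator [FiniteDimensional K H] (l : H →ₗ[K] K) (t : H ⊗[K] H) :
    LinearMap.trace K H (tensorOperator l t) =
      l (LinearMap.mul' K H (TensorProduct.comm K H H t)) := by
  induction t using TensorProduct.induction_on with
  | zero => simp
  | tmul a b => simp [tensorOperator, LinearMap.trace_smulRight]
  | add s t hs ht => simp only [map_add, hs, ht]

namespace IsNormalizedIntegral

variable {l : H →ₗ[K] K}

theorem mul_comm_lTensor_antipodeEquiv_symm_comul (hΛ : IsNormalizedIntegral K Λ) (y : H) :
    LinearMap.mul' K H (TensorProduct.comm K H H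
      (hΛ.antipodeEquiv.symm.toLinearMap.lTensor H (comul y))) = (counit y : K) • 1 := by
  apply hΛ.antipode_injective
  have h : ∀ t : H ⊗[K] H, antipode K (LinearMap.mul' K H (TensorProduct.comm K H H
      (hΛ.antipodeEquiv.symm.toLinearMap.lTensor H t))) =
      LinearMap.mul' K H ((antipode K).rTensor H t) := by
    intro t
    induction t using TensorProduct.induction_on with
    | zero => simp
    | tmul a b =>
      have hb : antipode K (hΛ.antipodeEquiv.symm b) = b := hΛ.antipodeEquiv.apply_symm_apply b
      simp [antipode_mul_antidistrib, hb]
    | add s t hs ht => simp only [map_add, hs, ht]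
  rw [h, mul_antipode_rTensor_comul_apply, map_smul, antipode_one, Algebra.algebraMap_eq_smul_one]

/-- Since `S⁻¹(x) = l(x Λ₍₁₎) Λ₍₂₎`, the operator `F ∘ S⁻¹` has trace `l(F(Λ₍₂₎) Λ₍₁₎)`; here
`F(x) = S⁻¹(x₍₁₎) f(x₍₂₎)`, and `S⁻¹(Λ₍₂₎) Λ₍₁₎ f(Λ₍₃₎) = f(Λ) 1`. -/
theorem trace_antipode_transRight (hΛ : IsNormalizedIntegral K Λ) (hl : transLeft l Λ = 1)
    (f : H →ₗ[K] K) :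
    LinearMap.trace K H (hΛ.antipodeEquiv.symm.toLinearMap ∘ₗ transRight f ∘ₗ
      hΛ.antipodeEquiv.symm.toLinearMap) = l 1 * f Λ := by
  have := hΛ.finiteDimensional
  have h1 : hΛ.antipodeEquiv.symm.toLinearMap ∘ₗ transRight f ∘ₗ
      hΛ.antipodeEquiv.symm.toLinearMap = tensorOperator l
        ((hΛ.antipodeEquiv.symm.toLinearMap ∘ₗ transRight f).lTensor H (comul Λ)) := by
    ext x
    obtain ⟨x, rfl⟩ := hΛ.antipodeEquiv.surjective x
    have h2 : ∀ (F : H →ₗ[K] H) (k : H →ₗ[K] K) (t : H ⊗[K] H),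
        sliceLeft H k (F.lTensor H t) = F (sliceLeft H k t) := by
      intro F k t
      induction t using TensorProduct.induction_on with
      | zero => simp
      | tmul a b => simp
      | add s t hs ht => simp only [map_add, hs, ht]
    rw [tensorOperator_apply, h2]
    have h3 := hΛ.transLeft_mulLeft_antipode hl x
    simp only [transLeft, LinearMap.comp_apply] at h3
    simp only [antipodeEquiv_apply, h3, LinearMap.comp_apply, LinearEquiv.coe_coe]
    rw [← hΛ.antipodeEquiv_apply, LinearEquiv.symm_apply_apply]
  rw [h1, trace_tensorOperator, LinearMap.lTensor_comp, LinearMap.comp_apply,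
    lTensor_transRight_comul, hΛ.mul_comm_lTensor_antipodeEquiv_symm_comul, counit_transRight,
    map_smul, smul_eq_mul, mul_comm]

end IsNormalizedIntegral

end DualIntegral

/-! ### Traces of operators of finite order -/

section FiniteOrder

variable {K V : Type*} [Field K] [AddCommGroup V] [Module K V]

theorem exists_trace_eq_natCast_of_isIdempotentElem [FiniteDimensional K V] {e : Module.End K V}
    (he : IsIdempotentElem e) :
    ∃ n : ℕ, n ≤ Module.finrank K V ∧ LinearMap.trace K V e = n :=
  ⟨Module.finrank K (LinearMap.range e), Submodule.finrank_le _,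
    (LinearMap.IsIdempotentElem.isProj_range e he).trace⟩

/-- The traces of the powers of an operator of finite order, in terms of the multiplicities of the
roots of unity as eigenvalues. -/
theorem exists_trace_pow_eq_sum [CharZero K] [FiniteDimensional K V] {N : ℕ} (hN : 0 < N) {ζ : K}
    (hζ : IsPrimitiveRoot ζ N) {T : Module.End K V} (hT : T ^ N = 1) :
    ∃ m : ℕ → ℕ, ∀ k : ℕ, LinearMap.trace K V (T ^ k) =
      ∑ j ∈ Finset.range N, (m j : K) * ζ ^ (j * k) := by
  have hN0 : (N : K) ≠ 0 := Nat.cast_ne_zero.2 hN.ne'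
  have hζ0 : ζ ≠ 0 := hζ.ne_zero hN.ne'
  -- `E j` is `N` times the projection onto the eigenspace of `ζ ^ j`.
  let E : ℕ → Module.End K V := fun j => ∑ k ∈ Finset.range N, ((ζ⁻¹ ^ j) • T) ^ k
  have hTE : ∀ j, T * E j = ζ ^ j • E j := by
    intro j
    have h1 : ((ζ⁻¹ ^ j) • T) ^ N = 1 := by
      rw [smul_pow, hT, ← pow_mul, mul_comm j, pow_mul, inv_pow, hζ.pow_eq_one]
      simp
    have h2 := mul_geom_sum ((ζ⁻¹ ^ j) • T) N
    rw [h1, sub_self, sub_mul, one_mul, sub_eq_zero, smul_mul_assoc] at h2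
    change _ = ζ ^ j • (∑ k ∈ Finset.range N, ((ζ⁻¹ ^ j) • T) ^ k)
    rw [← h2, smul_smul, ← mul_pow, mul_inv_cancel₀ hζ0, one_pow, one_smul]
  have hTkE : ∀ j k, T ^ k * E j = ζ ^ (j * k) • E j := by
    intro j k
    induction k with
    | zero => simp
    | succ k ih =>
      rw [pow_succ, mul_assoc, hTE, mul_smul_comm, ih, smul_smul, ← pow_add]
      congr 2; ring
  have hEE : ∀ j, E j * E j = (N : K) • E j := by
    intro j
    change (∑ k ∈ Finset.range N, ((ζ⁻¹ ^ j) • T) ^ k) * E j = _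
    rw [Finset.sum_mul]
    have : ∀ k ∈ Finset.range N, ((ζ⁻¹ ^ j) • T) ^ k * E j = E j := by
      intro k _
      rw [smul_pow, smul_mul_assoc, hTkE, smul_smul, ← pow_mul, ← mul_pow, inv_mul_cancel₀ hζ0,
        one_pow, one_smul]
    rw [Finset.sum_congr rfl this, Finset.sum_const, Finset.card_range, Nat.cast_smul_eq_nsmul]
  have hsum : ∑ j ∈ Finset.range N, E j = (N : K) • 1 := by
    change ∑ j ∈ Finset.range N, ∑ k ∈ Finset.range N, ((ζ⁻¹ ^ j) • T) ^ k = _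
    rw [Finset.sum_comm, Finset.sum_eq_single 0]
    · simp [Nat.cast_smul_eq_nsmul]
    · intro k hk hk0
      have h1 : ∀ j ∈ Finset.range N, ((ζ⁻¹ ^ j) • T) ^ k = ((ζ⁻¹ ^ k) ^ j) • T ^ k := by
        intro j _
        rw [smul_pow, ← pow_mul, ← pow_mul, mul_comm]
      rw [Finset.sum_congr rfl h1, ← Finset.sum_smul]
      have h2 : ζ⁻¹ ^ k ≠ 1 := hζ.inv.pow_ne_one_of_pos_of_lt hk0 (Finset.mem_range.1 hk)
      have h3 := mul_geom_sum (ζ⁻¹ ^ k) N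
      rw [← pow_mul, mul_comm k, pow_mul, hζ.inv.pow_eq_one, one_pow, sub_self] at h3
      rw [(mul_eq_zero.1 h3).resolve_left (sub_ne_zero.2 h2), zero_smul]
    · intro h
      exact absurd (Finset.mem_range.2 hN) h
  have hidem : ∀ j, IsIdempotentElem ((N : K)⁻¹ • E j) := by
    intro j
    rw [IsIdempotentElem, smul_mul_smul_comm, hEE, smul_smul, mul_assoc, inv_mul_cancel₀ hN0,
      mul_one]
  choose m _ hm using fun j => exists_trace_eq_natCast_of_isIdempotentElem (hidem j)
  refine ⟨m, fun k => ?_⟩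
  have h1 : T ^ k = ∑ j ∈ Finset.range N, ζ ^ (j * k) • ((N : K)⁻¹ • E j) := by
    have h2 : ∀ j, ζ ^ (j * k) • ((N : K)⁻¹ • E j) = (N : K)⁻¹ • (T ^ k * E j) := by
      intro j
      rw [hTkE, smul_comm]
    rw [Finset.sum_congr rfl fun j _ => h2 j, ← Finset.smul_sum, ← Finset.mul_sum, hsum,
      mul_smul_comm, mul_one, smul_smul, inv_mul_cancel₀ hN0, one_smul]
  rw [h1, map_sum]
  refine Finset.sum_congr rfl fun j _ => ?_
  rw [map_smul, hm, smul_eq_mul, mul_comm]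

end FiniteOrder

section Positivity

variable {K : Type*} [Field K] [CharZero K]

/-- A sum of expressions `s(ζ) s(ζ⁻¹)`, where each `s` has natural number coefficients, vanishes
only if all `s(ζ)` do: in a complex embedding of `ℚ(ζ)`, the summands are squared absolute
values. -/
theorem sum_root_eq_zero_of_sum_mul_eq_zero {N : ℕ} (hN : 0 < N) {ζ : K}
    (hζ : IsPrimitiveRoot ζ N) {ι : Type*} [Fintype ι] (m : ι → ℕ → ℕ)
    (h : ∑ i, (∑ j ∈ Finset.range N, (m i j : K) * ζ ^ j) *
      (∑ j ∈ Finset.range N, (m i j : K) * ζ⁻¹ ^ j) = 0) (i : ι) :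
    ∑ j ∈ Finset.range N, (m i j : K) * ζ ^ j = 0 := by
  have hint : IsIntegral ℚ ζ := (hζ.isIntegral hN).tower_top
  have : Algebra.IsAlgebraic ℚ (IntermediateField.adjoin ℚ {ζ}) :=
    IntermediateField.isAlgebraic_adjoin_simple hint
  let φ : IntermediateField.adjoin ℚ {ζ} →ₐ[ℚ] ℂ := IsAlgClosed.lift
  let g := IntermediateField.AdjoinSimple.gen ℚ ζ
  have hg : algebraMap _ K g = ζ := IntermediateField.AdjoinSimple.algebraMap_gen ℚ ζ
  have hinj : Function.Injective (algebraMap (IntermediateField.adjoin ℚ {ζ}) K) :=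
    (algebraMap (IntermediateField.adjoin ℚ {ζ}) K).injective
  have hgN : g ^ N = 1 := by
    apply hinj
    rw [map_pow, hg, hζ.pow_eq_one, map_one]
  have hconj : (φ g)⁻¹ = starRingEnd ℂ (φ g) := by
    apply Complex.inv_eq_conj
    exact Complex.norm_eq_one_of_pow_eq_one (by rw [← map_pow, hgN, map_one]) hN.ne'
  let s : ι → IntermediateField.adjoin ℚ {ζ} :=
    fun i => ∑ j ∈ Finset.range N, (m i j : IntermediateField.adjoin ℚ {ζ}) * g ^ j
  let s' : ι → IntermediateField.adjoin ℚ {ζ} :=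
    fun i => ∑ j ∈ Finset.range N, (m i j : IntermediateField.adjoin ℚ {ζ}) * g⁻¹ ^ j
  have hs : ∀ i, algebraMap _ K (s i) = ∑ j ∈ Finset.range N, (m i j : K) * ζ ^ j := by
    intro i
    simp only [s, map_sum, map_mul, map_natCast, map_pow, hg]
  have hs' : ∀ i, algebraMap _ K (s' i) = ∑ j ∈ Finset.range N, (m i j : K) * ζ⁻¹ ^ j := by
    intro i
    simp only [s', map_sum, map_mul, map_natCast, map_pow, map_inv₀, hg]
  have hφ : ∀ i, φ (s' i) = starRingEnd ℂ (φ (s i)) := by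
    intro i
    simp only [s, s', map_sum, map_mul, map_natCast, map_pow, map_inv₀, hconj]
  have h1 : ∑ i, s i * s' i = 0 := by
    apply hinj
    rw [map_zero, map_sum, ← h]
    exact Finset.sum_congr rfl fun i _ => by rw [map_mul, hs, hs']
  have h2 : ∑ i, Complex.normSq (φ (s i)) = 0 := by
    have := congrArg φ h1
    simp only [map_sum, map_mul, hφ, Complex.mul_conj, map_zero] at this
    exact_mod_cast this
  have h3 := (Finset.sum_eq_zero_iff_of_nonneg fun i _ => Complex.normSq_nonneg _).1 h2 i
    (Finset.mem_univ i)
  have h4 : s i = 0 := φ.injective ((Complex.normSq_eq_zero.1 h3).trans (map_zero φ).symm)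
  rw [← hs, h4, map_zero]

end Positivity

section Blocks

variable {K : Type*} [Field K]

theorem trace_conj_comp {V : Type*} [AddCommGroup V] [Module K V] [FiniteDimensional K V]
    (T U : Module.End K V) (τ : Module.End K (Module.End K V)) (hτ : ∀ x, τ x = T * x * U) :
    LinearMap.trace K _ τ = LinearMap.trace K V T * LinearMap.trace K V U := by
  have h : τ = LinearMap.mul K (Module.End K V) T ∘ₗ (LinearMap.mul K (Module.End K V)).flip U := by
    ext1 x
    simp [hτ, mul_assoc]
  rw [h]
  obtain ⟨t, rfl⟩ := (dualTensorHomEquiv K V V).surjective T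
  obtain ⟨u, rfl⟩ := (dualTensorHomEquiv K V V).surjective U
  clear h hτ τ
  induction t using TensorProduct.induction_on with
  | zero => simp
  | add s t hs ht => simp only [map_add, LinearMap.add_comp, hs, ht, add_mul]
  | tmul φ a =>
    induction u using TensorProduct.induction_on with
    | zero => simp
    | add s t hs ht => simp only [map_add, LinearMap.comp_add, hs, ht, mul_add]
    | tmul ψ b =>
      -- For operators of rank one, the composite itself has rank one.
      have h : LinearMap.mul K (Module.End K V) (dualTensorHomEquiv K V V (φ ⊗ₜ a)) ∘ₗ
          (LinearMap.mul K (Module.End K V)).flip (dualTensorHomEquiv K V V (ψ ⊗ₜ b)) =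
          LinearMap.smulRight (φ ∘ₗ LinearMap.applyₗ b) (dualTensorHom K V V (ψ ⊗ₜ a)) := by
        ext x v
        simp [smul_smul, mul_comm]
      have h' : ∀ x, dualTensorHomEquiv K V V x = dualTensorHom K V V x := fun x => by
        simp [dualTensorHomEquiv]
      rw [h, LinearMap.trace_smulRight, h', h', LinearMap.trace_eq_contract_apply,
        LinearMap.trace_eq_contract_apply]
      simp [mul_comm]

/-- An algebra automorphism of finite order of a full endomorphism algebra is conjugation by an
operator of finite order, so that its trace is a value `s(ζ) s(ζ⁻¹)`. -/
theorem exists_trace_algEquiv_end [CharZero K] [IsAlgClosed K] {V : Type*} [AddCommGroup V]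
    [Module K V] [FiniteDimensional K V] [Nontrivial V] {N : ℕ} (hN : 0 < N) {ζ : K}
    (hζ : IsPrimitiveRoot ζ N) (τ : Module.End K V ≃ₐ[K] Module.End K V)
    (hτ : ∀ x, (τ.toLinearMap ^ N) x = x) :
    ∃ m : ℕ → ℕ, LinearMap.trace K _ τ.toLinearMap =
      (∑ j ∈ Finset.range N, (m j : K) * ζ ^ j) * (∑ j ∈ Finset.range N, (m j : K) * ζ⁻¹ ^ j) := by
  obtain ⟨T, hT⟩ := τ.eq_linearEquivConjAlgEquiv
  let t : Module.End K V := T.toLinearMap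
  let u : Module.End K V := T.symm.toLinearMap
  have htu : t * u = 1 := by ext v; simp [t, u]
  have hut : u * t = 1 := by ext v; simp [t, u]
  have hτ1 : ∀ x, τ x = t * x * u := by
    intro x
    rw [hT]
    rfl
  have hτk : ∀ k x, (τ.toLinearMap ^ k) x = t ^ k * x * u ^ k := by
    intro k
    induction k with
    | zero => intro x; simp
    | succ k ih =>
      intro x
      rw [pow_succ', Module.End.mul_apply, ih, AlgEquiv.toLinearMap_apply, hτ1, pow_succ' t,
        pow_succ u]
      simp only [mul_assoc]
  have hcomm : u ^ N * t ^ N = 1 := by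
    rw [← (show Commute u t from hut.trans htu.symm).mul_pow, hut, one_pow]
  have hcomm' : t ^ N * u ^ N = 1 := by
    rw [← (show Commute t u from htu.trans hut.symm).mul_pow, htu, one_pow]
  have hcent : t ^ N ∈ Subalgebra.center K (Module.End K V) := by
    rw [Subalgebra.mem_center_iff]
    intro x
    have := hτ x
    rw [hτk] at this
    calc x * t ^ N = (t ^ N * x * u ^ N) * t ^ N := by rw [this]
      _ = t ^ N * x := by rw [mul_assoc, hcomm, mul_one]
  obtain ⟨c, hc⟩ := Algebra.IsCentral.mem_center_iff K |>.1 hcent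
  have hc0 : c ≠ 0 := by
    rintro rfl
    rw [map_zero] at hc
    rw [hc, zero_mul] at hcomm'
    exact zero_ne_one hcomm'
  obtain ⟨b, hb⟩ := IsAlgClosed.exists_pow_nat_eq c hN
  have hb0 : b ≠ 0 := by
    rintro rfl
    exact hc0 (by rw [← hb, zero_pow hN.ne'])
  have hbt : (b⁻¹ • t) ^ N = 1 := by
    rw [smul_pow, hc, Algebra.algebraMap_eq_smul_one, smul_smul, inv_pow, hb,
      inv_mul_cancel₀ hc0, one_smul]
  have hbu : b • u = (b⁻¹ • t) ^ (N - 1) := by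
    have h1 : (b • u) * (b⁻¹ • t) = 1 := by
      rw [smul_mul_smul_comm, mul_inv_cancel₀ hb0, hut, one_smul]
    have h2 : (b⁻¹ • t) * (b⁻¹ • t) ^ (N - 1) = 1 := by
      rw [← pow_succ', Nat.sub_add_cancel hN, hbt]
    calc b • u = (b • u) * ((b⁻¹ • t) * (b⁻¹ • t) ^ (N - 1)) := by rw [h2, mul_one]
      _ = _ := by rw [← mul_assoc, h1, one_mul]
  obtain ⟨m, hm⟩ := exists_trace_pow_eq_sum hN hζ hbt
  refine ⟨m, ?_⟩
  have h1 : LinearMap.trace K _ τ.toLinearMap =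
      LinearMap.trace K V (b⁻¹ • t) * LinearMap.trace K V (b • u) := by
    refine trace_conj_comp _ _ _ fun x => ?_
    rw [AlgEquiv.toLinearMap_apply, hτ1, smul_mul_assoc, smul_mul_smul_comm, inv_mul_cancel₀ hb0,
      one_smul]
  rw [h1, hbu, hm, ← pow_one (b⁻¹ • t), hm]
  congr 1
  · simp
  · refine Finset.sum_congr rfl fun j _ => ?_
    congr 1
    have : ζ ^ (N - 1) = ζ⁻¹ := by
      apply eq_inv_of_mul_eq_one_left
      rw [← pow_succ, Nat.sub_add_cancel hN, hζ.pow_eq_one]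
    rw [mul_comm, pow_mul, this]

end Blocks

/-! ### Traces of automorphisms of semisimple algebras -/

section PiBlocks

variable {K ι : Type*} [Field K] [DecidableEq ι] {E : ι → Type*}
  [∀ i, Ring (E i)] [∀ i, Algebra K (E i)]

theorem pi_single_one_mul_comm (i : ι) (x : ∀ i, E i) :
    (Pi.single i 1 : ∀ i, E i) * x = x * Pi.single i 1 := by
  ext j
  by_cases h : j = i
  · subst h; simp
  · simp [h]

theorem algEquiv_pi_single (τ : (∀ i, E i) ≃ₐ[K] (∀ i, E i))
    (hτ : ∀ z, (∀ x, z * x = x * z) → τ z = z) (i : ι) (x : E i) :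
    τ (Pi.single i x) = Pi.single i (τ (Pi.single i x) i) := by
  have h1 : (Pi.single i x : ∀ i, E i) = Pi.single i 1 * Pi.single i x := by
    rw [← Pi.single_mul, one_mul]
  rw [h1, map_mul, hτ _ (pi_single_one_mul_comm i)]
  ext j
  by_cases h : j = i
  · subst h; simp
  · simp [h]

/-- The restriction to the `i`-th factor of an automorphism of a product of algebras that fixes
the center. -/
noncomputable def piBlock (τ : (∀ i, E i) ≃ₐ[K] (∀ i, E i))
    (hτ : ∀ z, (∀ x, z * x = x * z) → τ z = z) (i : ι) : E i →ₐ[K] E i :=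
  AlgHom.ofLinearMap (LinearMap.proj i ∘ₗ τ.toLinearMap ∘ₗ LinearMap.single K E i)
    (by simp [hτ _ (pi_single_one_mul_comm i)])
    (fun x y => by simp [Pi.single_mul])

theorem piBlock_apply (τ : (∀ i, E i) ≃ₐ[K] (∀ i, E i))
    (hτ : ∀ z, (∀ x, z * x = x * z) → τ z = z) (i : ι) (x : E i) :
    piBlock τ hτ i x = τ (Pi.single i x) i := rfl

theorem piBlock_injective (τ : (∀ i, E i) ≃ₐ[K] (∀ i, E i))
    (hτ : ∀ z, (∀ x, z * x = x * z) → τ z = z) (i : ι) :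
    Function.Injective (piBlock τ hτ i) := by
  intro x y h
  rw [piBlock_apply, piBlock_apply] at h
  have h1 := algEquiv_pi_single τ hτ i x
  rw [h, ← algEquiv_pi_single τ hτ i y] at h1
  exact Pi.single_injective i (τ.injective h1)

theorem single_piBlock_pow (τ : (∀ i, E i) ≃ₐ[K] (∀ i, E i))
    (hτ : ∀ z, (∀ x, z * x = x * z) → τ z = z) (i : ι) (k : ℕ) (x : E i) :
    Pi.single i (((piBlock τ hτ i).toLinearMap ^ k) x) =
      (τ.toLinearMap ^ k) (Pi.single i x) := by
  induction k with
  | zero => simp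
  | succ k ih =>
    rw [pow_succ', pow_succ', Module.End.mul_apply, Module.End.mul_apply, ← ih,
      AlgEquiv.toLinearMap_apply, algEquiv_pi_single τ hτ]
    rfl

theorem trace_eq_sum_piBlock [Fintype ι] [∀ i, FiniteDimensional K (E i)]
    (τ : (∀ i, E i) ≃ₐ[K] (∀ i, E i)) (hτ : ∀ z, (∀ x, z * x = x * z) → τ z = z) :
    LinearMap.trace K _ τ.toLinearMap =
      ∑ i, LinearMap.trace K _ (piBlock τ hτ i).toLinearMap := by
  have h1 : τ.toLinearMap =
      ∑ i, (τ.toLinearMap ∘ₗ LinearMap.single K E i) ∘ₗ LinearMap.proj i := by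
    refine LinearMap.ext fun x => ?_
    simp only [LinearMap.sum_apply, LinearMap.comp_apply, LinearMap.proj_apply,
      LinearMap.coe_single]
    rw [← map_sum, Finset.univ_sum_single]
  conv_lhs => rw [h1]
  rw [map_sum]
  exact Finset.sum_congr rfl fun i _ => LinearMap.trace_comp_comm' _ _

end PiBlocks

/-- The trace of an algebra automorphism of finite order that fixes the center does not vanish on a
semisimple algebra with a one-dimensional representation: each simple block contributes a
nonnegative number, and the block of the one-dimensional representation contributes `1`. -/
theorem trace_algEquiv_ne_zero {K A : Type*} [Field K] [IsAlgClosed K] [CharZero K] [Ring A]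
    [Algebra K A] [FiniteDimensional K A] [IsSemisimpleRing A] (e : A →ₐ[K] K)
    (τ : A ≃ₐ[K] A) (hτ : ∀ z, (∀ x, z * x = x * z) → τ z = z) {N : ℕ} (hN : 0 < N)
    (hτN : ∀ x, (τ.toLinearMap ^ N) x = x) : LinearMap.trace K A τ.toLinearMap ≠ 0 := by
  obtain ⟨n, d, hd, ⟨φ₀⟩⟩ := IsSemisimpleRing.exists_algEquiv_pi_matrix_of_isAlgClosed K A
  let φ : A ≃ₐ[K] (∀ i, Module.End K (Fin (d i) → K)) :=
    φ₀.trans (AlgEquiv.piCongrRight fun i => Matrix.toLinAlgEquiv')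
  let τ' := (φ.symm.trans τ).trans φ
  have hτ'x : ∀ x, τ' (φ x) = φ (τ x) := fun x => by simp [τ']
  have hτ' : ∀ z, (∀ x, z * x = x * z) → τ' z = z := by
    intro z hz
    obtain ⟨z, rfl⟩ := φ.surjective z
    rw [hτ'x, hτ z]
    intro x
    apply φ.injective
    rw [map_mul, map_mul, hz]
  have hτ'N : ∀ x, (τ'.toLinearMap ^ N) x = x := by
    have h : ∀ k x, (τ'.toLinearMap ^ k) (φ x) = φ ((τ.toLinearMap ^ k) x) := by
      intro k
      induction k with
      | zero => intro x; simp
      | succ k ih =>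
        intro x
        rw [pow_succ', pow_succ', Module.End.mul_apply, Module.End.mul_apply, ih,
          AlgEquiv.toLinearMap_apply, AlgEquiv.toLinearMap_apply, hτ'x]
    intro x
    obtain ⟨x, rfl⟩ := φ.surjective x
    rw [h, hτN]
  have htr : LinearMap.trace K A τ.toLinearMap = LinearMap.trace K _ τ'.toLinearMap :=
    (LinearMap.trace_conj' τ.toLinearMap φ.toLinearEquiv).symm
  rw [htr, trace_eq_sum_piBlock τ' hτ']
  have : NeZero (N : K) := ⟨Nat.cast_ne_zero.2 hN.ne'⟩
  obtain ⟨ζ, hζ⟩ := HasEnoughRootsOfUnity.exists_primitiveRoot K N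
  have hblock : ∀ i, ∃ m : ℕ → ℕ, LinearMap.trace K _ (piBlock τ' hτ' i).toLinearMap =
      (∑ j ∈ Finset.range N, (m j : K) * ζ ^ j) *
        (∑ j ∈ Finset.range N, (m j : K) * ζ⁻¹ ^ j) := by
    intro i
    have hinj := piBlock_injective τ' hτ' i
    have hsurj : Function.Surjective (piBlock τ' hτ' i) :=
      (LinearMap.injective_iff_surjective (f := (piBlock τ' hτ' i).toLinearMap)).1 hinj
    refine exists_trace_algEquiv_end hN hζ (AlgEquiv.ofBijective _ ⟨hinj, hsurj⟩) fun x => ?_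
    apply Pi.single_injective (M := fun i => Module.End K (Fin (d i) → K)) i
    exact (single_piBlock_pow τ' hτ' i N x).trans (hτ'N _)
  choose m hm using hblock
  intro h0
  rw [Finset.sum_congr rfl fun i _ => hm i] at h0
  have hzero : ∀ i, LinearMap.trace K _ (piBlock τ' hτ' i).toLinearMap = 0 := fun i => by
    rw [hm, sum_root_eq_zero_of_sum_mul_eq_zero hN hζ m h0 i, zero_mul]
  let e' := e.comp φ.symm.toAlgHom
  obtain ⟨i, hi⟩ : ∃ i, e' (Pi.single i 1) ≠ 0 := by
    by_contra! h
    have h1 : e' (∑ i, Pi.single i 1) = 0 := by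
      rw [map_sum]
      exact Finset.sum_eq_zero fun i _ => h i
    have h2 : ∑ i, Pi.single i 1 = (1 : ∀ i, Module.End K (Fin (d i) → K)) :=
      Finset.univ_sum_single 1
    rw [h2, map_one] at h1
    exact one_ne_zero h1
  have hi1 : e' (Pi.single i 1) = 1 := by
    have : e' (Pi.single i 1) * e' (Pi.single i 1) = e' (Pi.single i 1) := by
      rw [← map_mul, ← Pi.single_mul, one_mul]
    exact mul_left_cancel₀ hi (this.trans (mul_one _).symm)
  let e'' : Module.End K (Fin (d i) → K) →ₐ[K] K :=
    AlgHom.ofLinearMap (e'.toLinearMap ∘ₗ LinearMap.single K (fun i => Module.End K (Fin (d i) → K)) i) (by simpa using hi1)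
      (fun x y => by simp [Pi.single_mul])
  have hone : ∀ x, piBlock τ' hτ' i x = x := by
    intro x
    have : IsSimpleRing (Module.End K (Fin (d i) → K)) :=
      IsSimpleRing.of_ringEquiv
        (Matrix.toLinAlgEquiv' (R := K) (n := Fin (d i))).toRingEquiv inferInstance
    have hinj : Function.Injective e'' := e''.toRingHom.injective
    have : x = algebraMap K _ (e'' x) := hinj (by simp)
    rw [this, AlgHom.commutes]
  have h1 := hzero i
  have h2 : (piBlock τ' hτ' i).toLinearMap = LinearMap.id := LinearMap.ext hone
  rw [h2, LinearMap.trace_id, Nat.cast_eq_zero] at h1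
  exact Module.finrank_pos.ne' h1

/-! ### The antipode is an involution -/

section RegularCharacter

variable {K H : Type*} [Field K] [Ring H] [HopfAlgebra K H]

/-- The character of the regular representation of `H`. -/
noncomputable def regularCharacter (K H : Type*) [Field K] [Ring H] [HopfAlgebra K H] :
    H →ₗ[K] K :=
  LinearMap.trace K H ∘ₗ LinearMap.mul K H

theorem regularCharacter_apply (h : H) :
    regularCharacter K H h = LinearMap.trace K H (LinearMap.mulLeft K h) := rfl

theorem IsNormalizedIntegral.regularCharacter_eq_one {Λ : H} [FiniteDimensional K H]
    (hΛ : IsNormalizedIntegral K Λ) : regularCharacter K H Λ = 1 := by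
  have h : LinearMap.mulLeft K Λ = LinearMap.smulRight (counit : H →ₗ[K] K) Λ := by
    ext x
    simp [hΛ.mul_right]
  rw [regularCharacter_apply, h, LinearMap.trace_smulRight, hΛ.counit_eq]

/-- The map `x ⊗ y ↦ x₍₁₎ ⊗ x₍₂₎ y`. -/
noncomputable def galoisMap (K H : Type*) [Field K] [Ring H] [HopfAlgebra K H] :
    H ⊗[K] H →ₗ[K] H ⊗[K] H :=
  LinearMap.mul' K (H ⊗[K] H) ∘ₗ TensorProduct.map comul
    (Algebra.TensorProduct.includeRight : H →ₐ[K] H ⊗[K] H).toLinearMap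

theorem galoisMap_tmul (x y : H) :
    galoisMap K H (x ⊗ₜ y) = comul x * ((1 : H) ⊗ₜ[K] y) := by
  simp [galoisMap]

theorem galoisMap_surjective : Function.Surjective (galoisMap K H) := by
  rw [← LinearMap.range_eq_top, eq_top_iff]
  intro t _
  induction t using TensorProduct.induction_on with
  | zero => exact zero_mem _
  | add s t hs ht => exact add_mem (hs trivial) (ht trivial)
  | tmul x y =>
    have h1 : toConv comul * convInclRightInv K H = convInclLeft K H := by
      rw [← convInclLeft_mul_convInclRight, mul_assoc, convInclRight_mul_inv, mul_one]
    have h2 : (x ⊗ₜ[K] (1 : H)) = LinearMap.mul' K _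
        (TensorProduct.map comul (convInclRightInv K H).ofConv (comul x)) :=
      (congrArg (fun φ => φ.ofConv x) h1).symm
    have h3 : x ⊗ₜ[K] y = (x ⊗ₜ[K] (1 : H)) * ((1 : H) ⊗ₜ[K] y) := by simp
    rw [h3, h2]
    induction (comul (R := K) x) using TensorProduct.induction_on with
    | zero => simp
    | add s t hs ht => rw [map_add, map_add, add_mul]; exact add_mem hs ht
    | tmul a b =>
      refine ⟨a ⊗ₜ (antipode K b * y), ?_⟩
      simp [galoisMap_tmul, convInclRightInv, mul_assoc]

/-- The regular character satisfies `χ * χ = (dim H) χ`, because `H ⊗ H` is a free `H`-module of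
rank `dim H`. -/
theorem conv_regularCharacter [FiniteDimensional K H] :
    conv (regularCharacter K H) (regularCharacter K H) =
      (Module.finrank K H : K) • regularCharacter K H := by
  ext h
  have h1 : ∀ t : H ⊗[K] H, LinearMap.mul' K K
      (TensorProduct.map (regularCharacter K H) (regularCharacter K H) t) =
      LinearMap.trace K (H ⊗[K] H) (LinearMap.mul K (H ⊗[K] H) t) := by
    intro t
    induction t using TensorProduct.induction_on with
    | zero => simp
    | add s t hs ht => simp only [map_add, hs, ht]
    | tmul x y =>
      have : LinearMap.mul K (H ⊗[K] H) (x ⊗ₜ y) =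
          TensorProduct.map (LinearMap.mulLeft K x) (LinearMap.mulLeft K y) := by
        ext a b
        simp
      rw [this, LinearMap.trace_tensorProduct']
      simp [regularCharacter_apply]
  let e : H ⊗[K] H ≃ₗ[K] H ⊗[K] H := LinearEquiv.ofBijective (galoisMap K H)
    ⟨LinearMap.injective_iff_surjective.2 galoisMap_surjective, galoisMap_surjective⟩
  have h2 : e.conj (TensorProduct.map (LinearMap.mulLeft K h) LinearMap.id) =
      LinearMap.mul K (H ⊗[K] H) (comul h) := by
    apply LinearMap.ext
    intro t
    obtain ⟨t, rfl⟩ := e.surjective t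
    rw [LinearEquiv.conj_apply_apply, LinearEquiv.symm_apply_apply]
    change galoisMap K H _ = comul h * galoisMap K H t
    induction t using TensorProduct.induction_on with
    | zero => simp
    | add s t hs ht => simp only [map_add, hs, ht, mul_add]
    | tmul x y => simp [galoisMap_tmul, mul_assoc]
  rw [conv_apply, h1, ← h2, LinearMap.trace_conj', LinearMap.trace_tensorProduct',
    LinearMap.trace_id, LinearMap.smul_apply, regularCharacter_apply, smul_eq_mul, mul_comm]

theorem antipodeSq_transRight (f : H →ₗ[K] K) (x : H) :
    antipodeSq K H (transRight (f ∘ₗ (antipodeSq K H).toLinearMap) x) =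
      transRight f (antipodeSq K H x) := by
  have h1 := antipode_transRight (f ∘ₗ antipode K) x
  have h2 := antipode_transLeft f (antipode K x)
  rw [← h1] at h2
  exact h2

end RegularCharacter

section Involution

variable {K V : Type*} [Field K] [CharZero K] [AddCommGroup V] [Module K V]
  [FiniteDimensional K V]

theorem exists_trace_eq_of_mul_self {P Q : Module.End K V} (hPP : P * P = P) (hPQ : P * Q = Q)
    (hQP : Q * P = Q) (hQQ : Q * Q = P) : ∃ z : ℤ, LinearMap.trace K V Q = z := by
  have h2 : (2⁻¹ : K) * 2⁻¹ * 2 = 2⁻¹ := by norm_num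
  have hp : IsIdempotentElem ((2⁻¹ : K) • (P + Q)) := by
    rw [IsIdempotentElem, smul_mul_smul_comm, mul_add, add_mul, add_mul, hPP, hPQ, hQP, hQQ,
      add_comm Q P, ← two_smul K (P + Q), smul_smul, h2]
  have hm : IsIdempotentElem ((2⁻¹ : K) • (P - Q)) := by
    have : (P - Q) * (P - Q) = (2 : K) • (P - Q) := by
      rw [mul_sub, sub_mul, sub_mul, hPP, hPQ, hQP, hQQ, two_smul]; abel
    rw [IsIdempotentElem, smul_mul_smul_comm, this, smul_smul, h2]
  obtain ⟨p, -, hp⟩ := exists_trace_eq_natCast_of_isIdempotentElem hp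
  obtain ⟨m, -, hm⟩ := exists_trace_eq_natCast_of_isIdempotentElem hm
  refine ⟨p - m, ?_⟩
  have : Q = (2⁻¹ : K) • (P + Q) - (2⁻¹ : K) • (P - Q) := by
    rw [← smul_sub, add_sub_sub_cancel, ← two_smul K Q, smul_smul]
    norm_num
  rw [this, map_sub, hp, hm]
  simp

/-- An involution that fixes a nonzero vector and whose trace is a nonzero multiple of the
dimension is the identity. -/
theorem eq_one_of_trace_eq_finrank_mul {Q : Module.End K V} (hQQ : Q * Q = 1) {v : V} (hv : v ≠ 0)
    (hQv : Q v = v) {z : ℤ} (hz : LinearMap.trace K V Q = Module.finrank K V * z)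
    (h0 : LinearMap.trace K V Q ≠ 0) : Q = 1 := by
  have hp : IsIdempotentElem ((2⁻¹ : K) • (1 + Q)) := by
    rw [IsIdempotentElem, smul_mul_smul_comm, mul_add, add_mul, add_mul, hQQ, mul_one, one_mul,
      mul_one, add_comm Q 1, ← two_smul K (1 + Q), smul_smul]
    norm_num
  have hQ : Q = (2 : K) • ((2⁻¹ : K) • (1 + Q)) - 1 := by
    rw [smul_smul]; norm_num
  obtain ⟨p, hple, hpt⟩ := exists_trace_eq_natCast_of_isIdempotentElem hp
  have htr : LinearMap.trace K V Q = 2 * p - Module.finrank K V := by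
    conv_lhs => rw [hQ]
    rw [map_sub, map_smul, hpt, LinearMap.trace_one, smul_eq_mul]
  have hint : (2 * p - Module.finrank K V : ℤ) = Module.finrank K V * z := by
    have := htr.symm.trans hz
    exact_mod_cast this
  have hne : (Module.finrank K V * z : ℤ) ≠ 0 := by
    rw [hz] at h0
    exact_mod_cast h0
  have hz0 : z ≠ 0 := right_ne_zero_of_mul hne
  have hpn : p = 0 ∨ p = Module.finrank K V := by
    rcases lt_or_gt_of_ne hz0 with h | h
    · left
      have : z ≤ -1 := by omega
      nlinarith
    · right
      have : 1 ≤ z := by omega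
      have : (Module.finrank K V : ℤ) ≤ p := by nlinarith
      omega
  rcases hpn with rfl | rfl
  · exfalso
    rw [Nat.cast_zero] at hpt
    have h1 := LinearMap.IsIdempotentElem.eq_zero_of_trace_eq_zero hp hpt
    have h2 := congrArg (fun T : Module.End K V => T v) h1
    simp only [LinearMap.smul_apply, LinearMap.add_apply, Module.End.one_apply, hQv,
      LinearMap.zero_apply, ← two_smul K v, smul_smul] at h2
    norm_num at h2
    exact hv h2
  · have h1 := LinearMap.IsIdempotentElem.eq_zero_of_trace_eq_zero hp.one_sub
      (by rw [map_sub, LinearMap.trace_one, hpt, sub_self])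
    rw [sub_eq_zero] at h1
    rw [hQ, ← h1, two_smul]
    abel

end Involution

section Involutive

variable {K H : Type*} [Field K] [IsAlgClosed K] [CharZero K] [Ring H] [HopfAlgebra K H]
  [IsSemisimpleRing H] {Λ : H} {l : H →ₗ[K] K}

namespace IsNormalizedIntegral

/-- The dual of `H` is semisimple as well: its integral does not vanish at `1`. The value at `1` is
the trace of the inverse of `S²`. -/
theorem apply_one_ne_zero (hΛ : IsNormalizedIntegral K Λ) (hl : transLeft l Λ = 1) : l 1 ≠ 0 := by
  have := hΛ.finiteDimensional
  let σ : H ≃ₐ[K] H := AlgEquiv.ofBijective (antipodeSq K H)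
    (hΛ.antipode_bijective.comp hΛ.antipode_bijective)
  have hσ : ∀ x, σ x = antipode K (antipode K x) := fun x => rfl
  obtain ⟨M, hM, hσM⟩ := hΛ.exists_antipodeSq_pow_eq_one
  have hσk : ∀ k x, (σ.symm.toLinearMap ^ k) ((antipodeSq K H ^ k) x) = x := by
    intro k
    induction k with
    | zero => intro x; simp
    | succ k ih =>
      intro x
      rw [pow_succ, pow_succ', Module.End.mul_apply, AlgHom.mul_apply, AlgEquiv.toLinearMap_apply]
      exact (congrArg _ (σ.symm_apply_apply _)).trans (ih x)
  have h1 := trace_algEquiv_ne_zero (Bialgebra.counitAlgHom K H) σ.symm (fun z hz => by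
      rw [AlgEquiv.symm_apply_eq, hσ, hΛ.antipode_antipode_of_mem_center hz]) hM (fun x => by
      simpa [hσM] using hσk M x)
  have h2 := hΛ.trace_antipode_transRight hl counit
  rw [hΛ.counit_eq, mul_one] at h2
  rw [← h2]
  convert h1 using 2
  ext x
  simp only [LinearMap.comp_apply, LinearEquiv.coe_coe, transRight_counit,
    AlgEquiv.toLinearMap_apply]
  rw [eq_comm, AlgEquiv.symm_apply_eq, hσ, ← hΛ.antipodeEquiv_apply, ← hΛ.antipodeEquiv_apply,
    LinearEquiv.apply_symm_apply, LinearEquiv.apply_symm_apply]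

theorem antipode_pow_four (hΛ : IsNormalizedIntegral K Λ) (h : H) :
    antipode K (antipode K (antipode K (antipode K h))) = h := by
  obtain ⟨l, hl⟩ := hΛ.exists_transLeft_eq_one
  have ha : transRight l Λ = 1 := by
    refine eq_of_forall_dual (K := K) fun f => ?_
    have h1 := congrArg (fun g => g 1) (hΛ.conv_right_eq hl f)
    simp only [← apply_transLeft, transLeft_one, map_smul, LinearMap.smul_apply, smul_eq_mul] at h1
    exact (mul_right_cancel₀ (hΛ.apply_one_ne_zero hl) h1).symm
  have h1 := hΛ.antipode_pow_four_mul hl h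
  rwa [ha, mul_one, one_mul] at h1

theorem trace_transRight_mul_antipodeSq (hΛ : IsNormalizedIntegral K Λ) (hl : transLeft l Λ = 1)
    (f : H →ₗ[K] K) :
    LinearMap.trace K H (transRight f ∘ₗ (antipodeSq K H).toLinearMap) = l 1 * f Λ := by
  have := hΛ.finiteDimensional
  rw [← hΛ.trace_antipode_transRight hl f]
  rw [LinearMap.trace_comp_comm' (transRight f ∘ₗ hΛ.antipodeEquiv.symm.toLinearMap),
    LinearMap.comp_assoc]
  congr 2
  ext x
  simp only [LinearMap.comp_apply, LinearEquiv.coe_coe, AlgHom.toLinearMap_apply]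
  rw [eq_comm, LinearEquiv.symm_apply_eq, LinearEquiv.symm_apply_eq, antipodeEquiv_apply,
    antipodeEquiv_apply, antipodeSq_apply, hΛ.antipode_pow_four]

/-- The Larson–Radford theorem: the antipode of a semisimple Hopf algebra over a field of
characteristic zero is an involution. The trace of `S²` is divisible by the dimension, because the
trace of its restriction to the range of the convolution idempotent of the regular character is an
integer. -/
theorem antipode_antipode (hΛ : IsNormalizedIntegral K Λ) (h : H) :
    antipode K (antipode K h) = h := by
  have := hΛ.finiteDimensional
  obtain ⟨l, hl⟩ := hΛ.exists_transLeft_eq_one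
  have hl0 := hΛ.apply_one_ne_zero hl
  have h10 : (1 : H) ≠ 0 := by
    intro h0
    rw [h0, map_zero] at hl0
    exact hl0 rfl
  have : Nontrivial H := ⟨1, 0, h10⟩
  have hn0 : (Module.finrank K H : K) ≠ 0 := Nat.cast_ne_zero.2 Module.finrank_pos.ne'
  set n := Module.finrank K H
  let Q : Module.End K H := (antipodeSq K H).toLinearMap
  let R : Module.End K H := transRight (regularCharacter K H)
  let P : Module.End K H := (n : K)⁻¹ • R
  have hQQ : Q * Q = 1 := LinearMap.ext fun x => hΛ.antipode_pow_four x
  have hRR : R * R = (n : K) • R := by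
    ext x
    refine (transRight_transRight _ _ x).trans (eq_of_forall_dual (K := K) fun k => ?_)
    have h1 : conv k ((n : K) • regularCharacter K H) =
        (n : K) • conv k (regularCharacter K H) := by
      ext y
      simp [conv_apply, TensorProduct.map_smul_right]
    rw [conv_regularCharacter, apply_transRight, h1, LinearMap.smul_apply, LinearMap.smul_apply,
      map_smul, apply_transRight]
  have hPP : P * P = P := by
    rw [smul_mul_smul_comm, hRR, smul_smul, mul_assoc, inv_mul_cancel₀ hn0, mul_one]
  have hχ : regularCharacter K H ∘ₗ Q = regularCharacter K H := by
    ext x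
    have h1 : LinearMap.mulLeft K (Q x) = Q * (LinearMap.mulLeft K x * Q) := by
      refine LinearMap.ext fun y => ?_
      change Q x * y = antipodeSq K H (x * Q y)
      rw [map_mul]
      congr 1
      exact (LinearMap.congr_fun hQQ y).symm
    rw [LinearMap.comp_apply, regularCharacter_apply, regularCharacter_apply, h1,
      LinearMap.trace_mul_comm, mul_assoc, hQQ, mul_one]
  have hRQ : R * Q = Q * R := by
    refine LinearMap.ext fun x => ?_
    have h1 := antipodeSq_transRight (regularCharacter K H) x
    change regularCharacter K H ∘ₗ (antipodeSq K H).toLinearMap = _ at hχ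
    rw [hχ] at h1
    exact h1.symm
  have hPQ : P * Q = Q * P := by
    rw [smul_mul_assoc, hRQ, mul_smul_comm]
  obtain ⟨z, hz⟩ := exists_trace_eq_of_mul_self (P := P) (Q := P * Q) hPP
    (by rw [← mul_assoc, hPP]) (by rw [mul_assoc, ← hPQ, ← mul_assoc, hPP])
    (by rw [mul_assoc, ← mul_assoc Q, ← hPQ, mul_assoc P Q, hQQ, mul_one, hPP])
  have htrQ : LinearMap.trace K H Q = l 1 := by
    have h1 := hΛ.trace_transRight_mul_antipodeSq hl counit
    rw [hΛ.counit_eq, mul_one] at h1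
    rw [← h1]
    congr 1
    ext x
    exact (transRight_counit _).symm
  have htrR : LinearMap.trace K H (R * Q) = l 1 := by
    have h1 := hΛ.trace_transRight_mul_antipodeSq hl (regularCharacter K H)
    rwa [hΛ.regularCharacter_eq_one, mul_one] at h1
  have hQ1 : Q = 1 := by
    refine eq_one_of_trace_eq_finrank_mul hQQ h10 (map_one (antipodeSq K H)) (z := z) ?_
      (by rwa [htrQ])
    rw [← hz, smul_mul_assoc, map_smul, htrR, htrQ, smul_eq_mul, ← mul_assoc, mul_inv_cancel₀ hn0,
      one_mul]
  exact LinearMap.congr_fun hQ1 h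

/-- The dual of `H` acts on `H` by `f • x = x₍₁₎ f(x₍₂₎)`, and the character of this representation
is evaluation at `(dim H) Λ`. -/
theorem trace_transRight (hΛ : IsNormalizedIntegral K Λ) (f : H →ₗ[K] K) :
    LinearMap.trace K H (transRight f) = Module.finrank K H * f Λ := by
  have := hΛ.finiteDimensional
  obtain ⟨l, hl⟩ := hΛ.exists_transLeft_eq_one
  have hσ : (antipodeSq K H).toLinearMap = LinearMap.id :=
    LinearMap.ext fun x => hΛ.antipode_antipode x
  have h1 : ∀ f, LinearMap.trace K H (transRight f) = l 1 * f Λ := by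
    intro f
    rw [← hΛ.trace_transRight_mul_antipodeSq hl f, hσ, LinearMap.comp_id]
  have h2 : transRight (counit : H →ₗ[K] K) = LinearMap.id := LinearMap.ext transRight_counit
  have h3 := h1 counit
  rw [h2, LinearMap.trace_id, hΛ.counit_eq, mul_one] at h3
  rw [h1, h3]

/-- The integral is cocommutative. -/
theorem conv_comm_apply (hΛ : IsNormalizedIntegral K Λ) (f g : H →ₗ[K] K) :
    conv f g Λ = conv g f Λ := by
  have := hΛ.finiteDimensional
  have h1 : ∀ f g : H →ₗ[K] K, transRight (conv f g) = transRight f * transRight g :=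
    fun f g => LinearMap.ext fun x => (transRight_transRight f g x).symm
  have h2 : (Module.finrank K H : K) ≠ 0 := by
    have : Nontrivial H := by
      refine ⟨Λ, 0, fun h => ?_⟩
      have := hΛ.counit_eq
      rw [h, map_zero] at this
      exact zero_ne_one this
    exact Nat.cast_ne_zero.2 Module.finrank_pos.ne'
  apply mul_left_cancel₀ h2
  rw [← hΛ.trace_transRight, ← hΛ.trace_transRight, h1, h1, LinearMap.trace_mul_comm]

end IsNormalizedIntegral

end Involutive

/-! ### Cyclotomic fields -/

section Cyclotomic

variable {K : Type*} [Field K]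

theorem adjoin_inf_adjoin_eq_bot [CharZero K] {m q : ℕ} (hm : 0 < m) (hq : 0 < q) (hmq : m.Coprime q) {ζ : K}
    (hζ : IsPrimitiveRoot ζ (m * q)) :
    IntermediateField.adjoin ℚ {ζ ^ q} ⊓ IntermediateField.adjoin ℚ {ζ ^ m} = ⊥ := by
  have hmq0 : 0 < m * q := Nat.mul_pos hm hq
  have h1 : IsPrimitiveRoot (ζ ^ q) m := hζ.pow hmq0 (mul_comm m q)
  have h2 : IsPrimitiveRoot (ζ ^ m) q := hζ.pow hmq0 rfl
  have hrank : ∀ {n : ℕ} {μ : K}, 0 < n → IsPrimitiveRoot μ n →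
      Module.finrank ℚ (IntermediateField.adjoin ℚ {μ}) = n.totient := by
    intro n μ hn hμ
    rw [IntermediateField.adjoin.finrank (hμ.isIntegral hn).tower_top,
      ← Polynomial.cyclotomic_eq_minpoly_rat hμ hn, Polynomial.natDegree_cyclotomic]
  have hsup : IntermediateField.adjoin ℚ {ζ ^ q} ⊔ IntermediateField.adjoin ℚ {ζ ^ m} =
      IntermediateField.adjoin ℚ {ζ} := by
    apply le_antisymm
    · refine sup_le ?_ ?_ <;> rw [IntermediateField.adjoin_simple_le_iff] <;>
        exact pow_mem (IntermediateField.mem_adjoin_simple_self ℚ ζ) _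
    · rw [IntermediateField.adjoin_simple_le_iff]
      have hζ0 : ζ ≠ 0 := hζ.ne_zero hmq0.ne'
      have hbez := Nat.gcd_eq_gcd_ab m q
      rw [hmq.gcd_eq_one] at hbez
      have : ζ = (ζ ^ q) ^ (m.gcdB q) * (ζ ^ m) ^ (m.gcdA q) := by
        rw [← zpow_natCast, ← zpow_natCast, ← zpow_mul, ← zpow_mul, ← zpow_add₀ hζ0, add_comm,
          ← hbez]
        simp
      have hq' : ζ ^ q ∈ IntermediateField.adjoin ℚ {ζ ^ q} ⊔ IntermediateField.adjoin ℚ {ζ ^ m} :=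
        IntermediateField.adjoin_simple_le_iff.1 le_sup_left
      have hm' : ζ ^ m ∈ IntermediateField.adjoin ℚ {ζ ^ q} ⊔ IntermediateField.adjoin ℚ {ζ ^ m} :=
        IntermediateField.adjoin_simple_le_iff.1 le_sup_right
      have hmem := mul_mem (zpow_mem hq' (m.gcdB q)) (zpow_mem hm' (m.gcdA q))
      rwa [← this] at hmem
  have : FiniteDimensional ℚ (IntermediateField.adjoin ℚ {ζ ^ q}) :=
    IntermediateField.adjoin.finiteDimensional (h1.isIntegral hm).tower_top
  have : FiniteDimensional ℚ (IntermediateField.adjoin ℚ {ζ ^ m}) :=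
    IntermediateField.adjoin.finiteDimensional (h2.isIntegral hq).tower_top
  apply IntermediateField.LinearDisjoint.inf_eq_bot
  apply IntermediateField.LinearDisjoint.of_finrank_sup
  rw [hsup, hrank hmq0 hζ, hrank hm h1, hrank hq h2, Nat.totient_mul hmq]

theorem isIntegral_sum_natCast_mul_pow {m : ℕ} (hm : 0 < m) {ζ : K} (hζ : IsPrimitiveRoot ζ m)
    (c : ℕ → ℕ) : IsIntegral ℤ (∑ j ∈ Finset.range m, (c j : K) * ζ ^ j) :=
  IsIntegral.sum _ fun j _ => (isIntegral_natCast (c j)).mul ((hζ.isIntegral hm).pow j)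

theorem sum_natCast_mul_pow_mem_adjoin [CharZero K] (m : ℕ) (ζ : K) (c : ℕ → ℕ) :
    ∑ j ∈ Finset.range m, (c j : K) * ζ ^ j ∈ IntermediateField.adjoin ℚ {ζ} :=
  sum_mem fun j _ => mul_mem (natCast_mem _ _)
    (pow_mem (IntermediateField.mem_adjoin_simple_self ℚ ζ) j)

theorem exists_int_eq_of_isIntegral_of_mem_bot [CharZero K] {x : K} (hx : IsIntegral ℤ x)
    (h : x ∈ (⊥ : IntermediateField ℚ K)) : ∃ z : ℤ, x = z := by
  obtain ⟨r, rfl⟩ := IntermediateField.mem_bot.1 h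
  have hr : IsIntegral ℤ r := (isIntegral_algebraMap_iff (algebraMap ℚ K).injective).1 hx
  obtain ⟨z, rfl⟩ := IsIntegrallyClosed.isIntegral_iff.1 hr
  exact ⟨z, by simp⟩

end Cyclotomic

/-! ### Matrix coefficients and Sweedler powers -/

section Coefficients

variable {K H V : Type*} [Field K] [Ring H] [HopfAlgebra K H] [AddCommGroup V] [Module K V]
  [Module H V] [IsScalarTower K H V] {ι : Type*} [Fintype ι] [DecidableEq ι]

/-- The matrix coefficient `h ↦ h_{ij}` of an `H`-module with respect to a basis. -/
noncomputable def matrixCoeff (H : Type*) [Ring H] [HopfAlgebra K H] [Module H V]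
    [IsScalarTower K H V] (b : Module.Basis ι K V) (i j : ι) : H →ₗ[K] K where
  toFun h := LinearMap.toMatrix b b (Algebra.lsmul K K V h) i j
  map_add' x y := by simp
  map_smul' c x := by simp

/-- The matrix of matrix coefficients, with entries in the convolution algebra of the dual. -/
noncomputable def coeffMatrix (H : Type*) [Ring H] [HopfAlgebra K H] [Module H V]
    [IsScalarTower K H V] (b : Module.Basis ι K V) : Matrix ι ι (WithConv (H →ₗ[K] K)) :=
  Matrix.of fun i j => toConv (matrixCoeff H b i j)

theorem matrixCoeff_mul (b : Module.Basis ι K V) (i j : ι) (x y : H) :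
    matrixCoeff H b i j (x * y) = ∑ k, matrixCoeff H b i k x * matrixCoeff H b k j y := by
  change LinearMap.toMatrix b b (Algebra.lsmul K K V (x * y)) i j = _
  rw [map_mul, LinearMap.toMatrix_mul, Matrix.mul_apply]
  rfl

theorem matrixCoeff_algebraMap (b : Module.Basis ι K V) (i j : ι) (c : K) :
    matrixCoeff H b i j (algebraMap K H c) = c * (1 : Matrix ι ι K) i j := by
  change LinearMap.toMatrix b b (Algebra.lsmul K K V (algebraMap K H c)) i j = _
  rw [AlgHom.commutes, Algebra.algebraMap_eq_smul_one, map_smul, LinearMap.toMatrix_one,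
    Matrix.smul_apply, smul_eq_mul]

theorem conv_one_apply (x : H) :
    (1 : WithConv (H →ₗ[K] K)).ofConv x = counit x := by
  simp [LinearMap.convOne_def]

/-- The powers of the matrix of matrix coefficients describe the action of Sweedler powers. -/
theorem coeffMatrix_pow_apply (b : Module.Basis ι K V) (m : ℕ) (i j : ι) (h : H) :
    ((coeffMatrix H b ^ m) i j).ofConv h = matrixCoeff H b i j (sweedlerPower K m h) := by
  induction m generalizing i j h with
  | zero =>
    rw [pow_zero, sweedlerPower_zero, matrixCoeff_algebraMap]
    by_cases hij : i = j
    · subst hij; rw [Matrix.one_apply_eq, Matrix.one_apply_eq, conv_one_apply, mul_one]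
    · rw [Matrix.one_apply_ne hij, Matrix.one_apply_ne hij, mul_zero]; rfl
  | succ m ih =>
    rw [pow_succ, Matrix.mul_apply, sweedlerPower_succ, ofConv_sum, LinearMap.sum_apply]
    have h1 : ∀ k, ((coeffMatrix H b ^ m) i k * coeffMatrix H b k j).ofConv h =
        LinearMap.mul' K K (TensorProduct.map ((coeffMatrix H b ^ m) i k).ofConv
          (matrixCoeff H b k j) (comul h)) := fun k => rfl
    simp only [h1]
    induction (comul (R := K) h) using TensorProduct.induction_on with
    | zero => simp
    | add s t hs ht => simp only [map_add, Finset.sum_add_distrib, hs, ht]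
    | tmul x y =>
      simp only [TensorProduct.map_tmul, LinearMap.mul'_apply, ih, LinearMap.id_apply,
        matrixCoeff_mul]
      rfl

theorem character_eq_sum (b : Module.Basis ι K V) (h : H) :
    character K H V h = ∑ i, matrixCoeff H b i i h := by
  rw [character, LinearMap.comp_apply, LinearMap.trace_eq_matrix_trace K b]
  rfl

theorem coeffMatrix_pow_eq_one (b : Module.Basis ι K V) {d : ℕ}
    (hd : ∀ (h : H) (v : V), sweedlerPower K d h • v = (counit h : K) • v) :
    coeffMatrix H b ^ d = 1 := by
  ext i j h
  rw [coeffMatrix_pow_apply]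
  have h1 : Algebra.lsmul K K V (sweedlerPower K d h) =
      Algebra.lsmul K K V (algebraMap K H (counit h)) := by
    ext v
    simp [hd]
  have h2 : matrixCoeff H b i j (sweedlerPower K d h) =
      matrixCoeff H b i j (algebraMap K H (counit h)) := by
    change LinearMap.toMatrix b b _ i j = LinearMap.toMatrix b b _ i j
    rw [h1]
  rw [h2, ← sweedlerPower_zero, ← coeffMatrix_pow_apply, pow_zero]

end Coefficients

/-! ### Indicators and the action of the dual -/

section DualAction

variable {K H : Type*} [Field K] [Ring H] [HopfAlgebra K H] {ι : Type*} [Fintype ι]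
  [DecidableEq ι]

/-- The action `f • x = x₍₁₎ f(x₍₂₎)` of the dual of `H` on `H`. -/
noncomputable def dualAction (K H : Type*) [Field K] [Ring H] [HopfAlgebra K H] :
    WithConv (H →ₗ[K] K) →+* Module.End K H where
  toFun f := transRight f.ofConv
  map_one' := by
    refine LinearMap.ext fun x => eq_of_forall_dual (K := K) fun k => ?_
    rw [apply_transRight]
    exact LinearMap.congr_fun (congrArg ofConv (mul_one (toConv k))) x
  map_mul' f g := LinearMap.ext fun x => (transRight_transRight f.ofConv g.ofConv x).symm
  map_zero' := by
    refine LinearMap.ext fun x => ?_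
    simp [transRight, sliceRight]
  map_add' f g := by
    refine LinearMap.ext fun x => ?_
    simp [transRight, sliceRight, LinearMap.lTensor_add]

/-- The action of matrices over the dual of `H` on column vectors with entries in `H`. -/
noncomputable def dualMatrixAction (K H ι : Type*) [Field K] [Ring H] [HopfAlgebra K H] [Fintype ι]
    [DecidableEq ι] : Matrix ι ι (WithConv (H →ₗ[K] K)) →+* Module.End K (ι → H) :=
  (endVecRingEquivMatrixEnd ι K H).symm.toRingHom.comp (dualAction K H).mapMatrix

theorem trace_dualMatrixAction [FiniteDimensional K H] (M : Matrix ι ι (WithConv (H →ₗ[K] K))) :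
    LinearMap.trace K (ι → H) (dualMatrixAction K H ι M) =
      ∑ i, LinearMap.trace K H (transRight (M i i).ofConv) := by
  set T := dualMatrixAction K H ι M with hT
  have h1 : T = ∑ i, (T ∘ₗ LinearMap.single K (fun _ => H) i) ∘ₗ LinearMap.proj i := by
    refine LinearMap.ext fun x => ?_
    simp only [LinearMap.sum_apply, LinearMap.comp_apply, LinearMap.proj_apply,
      LinearMap.coe_single]
    rw [← map_sum, Finset.univ_sum_single]
  conv_lhs => rw [h1]
  rw [map_sum]
  refine Finset.sum_congr rfl fun i _ => ?_
  rw [LinearMap.trace_comp_comm']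
  congr 1
  refine LinearMap.ext fun x => ?_
  change ∑ j, (transRight (M i j).ofConv) ((Pi.single i x : ι → H) j) = _
  rw [Finset.sum_eq_single i]
  · simp
  · intro j _ hj; simp [hj]
  · simp

end DualAction

section SecondFormula

variable {K H V : Type*} [Field K] [IsAlgClosed K] [CharZero K] [Ring H] [HopfAlgebra K H]
  [IsSemisimpleRing H] [AddCommGroup V] [Module K V] [Module H V] [IsScalarTower K H V]
  [FiniteDimensional K V] {Λ : H}

/-- Up to the factor `dim H`, the value `χ(Λ^{[m]})` is the trace of the `m`-th power of an operator
of order dividing `d`; so it lies in the field of `q`-th roots of unity if `d ∣ m q`. -/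
theorem character_sweedlerPower_mem_adjoin (hΛ : IsNormalizedIntegral K Λ) {d m q : ℕ}
    (hd : ∀ (h : H) (v : V), sweedlerPower K d h • v = (counit h : K) • v) (hq : 0 < q)
    (hdmq : d ∣ m * q) {ζ : K} (hζ : IsPrimitiveRoot ζ q) :
    character K H V (sweedlerPower K m Λ) ∈ IntermediateField.adjoin ℚ {ζ} := by
  have := hΛ.finiteDimensional
  have : Nontrivial H := by
    refine ⟨Λ, 0, fun h => ?_⟩
    have := hΛ.counit_eq
    rw [h, map_zero] at this
    exact zero_ne_one this
  have hn : (Module.finrank K H : K) ≠ 0 := Nat.cast_ne_zero.2 Module.finrank_pos.ne'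
  let b := Module.finBasis K V
  let M := coeffMatrix H b
  have hM : (M ^ m) ^ q = 1 := by
    obtain ⟨c, hc⟩ := hdmq
    rw [← pow_mul, hc, pow_mul, coeffMatrix_pow_eq_one b hd, one_pow]
  have hT : dualMatrixAction K H _ (M ^ m) ^ q = 1 := by rw [← map_pow, hM, map_one]
  obtain ⟨c, hc⟩ := exists_trace_pow_eq_sum hq hζ hT
  have h1 := hc 1
  rw [pow_one, trace_dualMatrixAction] at h1
  simp only [hΛ.trace_transRight, mul_one] at h1
  rw [← Finset.mul_sum] at h1
  have h2 : character K H V (sweedlerPower K m Λ) =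
      (Module.finrank K H : K)⁻¹ * ∑ j ∈ Finset.range q, (c j : K) * ζ ^ j := by
    rw [← h1, ← mul_assoc, inv_mul_cancel₀ hn, one_mul, character_eq_sum b]
    exact Finset.sum_congr rfl fun i _ => (coeffMatrix_pow_apply b m i i Λ).symm
  rw [h2]
  exact mul_mem (inv_mem (natCast_mem _ _)) (sum_natCast_mul_pow_mem_adjoin q ζ c)

end SecondFormula

/-! ### Indicators as traces of rotations -/

section Cyclic

/-- If `P` is an idempotent matrix that is invariant under a permutation `e` of the indices with
`e ^ m = 1`, then `∑ P_{x, e x}` is, up to a natural number, a sum of `m`-th roots of unity. -/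
theorem exists_sum_apply_perm_eq {K X : Type*} [Field K] [CharZero K] [Fintype X]
    [DecidableEq X] {P : Matrix X X K} (hP : P * P = P) {e : Equiv.Perm X}
    (he : ∀ x y, P (e x) (e y) = P x y) {m : ℕ} (hm : 0 < m) (hem : e ^ m = 1) {ζ : K}
    (hζ : IsPrimitiveRoot ζ m) :
    ∃ (c : ℕ → ℕ) (n : ℕ), ∑ x, P x (e x) = ∑ j ∈ Finset.range m, (c j : K) * ζ ^ j - n := by
  let Q : Matrix X X K := Matrix.of fun y x => if y = e x then 1 else 0
  have hPQ : ∀ x y, (P * Q) x y = P x (e y) := by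
    intro x y
    simp [Matrix.mul_apply, Q]
  have hQP : ∀ x y, (Q * P) (e x) y = P x y := by
    intro x y
    simp [Matrix.mul_apply, Q]
  have hcomm : P * Q = Q * P := by
    ext x y
    obtain ⟨x, rfl⟩ := e.surjective x
    rw [hPQ, hQP, he]
  have hQk : ∀ k x y, (Q ^ k) x y = if x = (e ^ k) y then 1 else 0 := by
    intro k
    induction k with
    | zero => intro x y; simp [Matrix.one_apply]
    | succ k ih =>
      intro x y
      rw [pow_succ, Matrix.mul_apply]
      simp [ih, Q, pow_succ]
  have hQm : Q ^ m = 1 := by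
    ext x y
    rw [hQk, hem, Equiv.Perm.one_apply, Matrix.one_apply]
  -- On the range of `P` act by `Q`, and on its kernel by the identity.
  let T : Matrix X X K := P * Q + (1 - P)
  have hP1 : P * (1 - P) = 0 := by rw [mul_sub, mul_one, hP, sub_self]
  have hP2 : (1 - P) * P = 0 := by rw [sub_mul, one_mul, hP, sub_self]
  have hTk : ∀ k, T ^ k = P * Q ^ k + (1 - P) := by
    intro k
    induction k with
    | zero => simp
    | succ k ih =>
      have hPk : P * Q ^ k = Q ^ k * P := (show Commute P Q from hcomm).pow_right k
      have h1 : P * Q ^ k * (P * Q) = P * Q ^ (k + 1) := by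
        rw [hPk, mul_assoc, ← mul_assoc P P, hP, ← mul_assoc, ← hPk, mul_assoc, ← pow_succ]
      have h2 : P * Q ^ k * (1 - P) = 0 := by rw [hPk, mul_assoc, hP1, mul_zero]
      have h3 : (1 - P) * (P * Q) = 0 := by rw [← mul_assoc, hP2, zero_mul]
      have h4 : (1 - P) * (1 - P) = 1 - P := by rw [sub_mul, one_mul, hP1, sub_zero]
      rw [pow_succ, ih, mul_add, add_mul, add_mul, h1, h2, h3, h4, zero_add, add_zero]
  have hTm : Matrix.toLinAlgEquiv' T ^ m = 1 := by
    rw [← map_pow, hTk, hQm, mul_one, add_sub_cancel, map_one]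
  obtain ⟨c, hc⟩ := exists_trace_pow_eq_sum hm hζ hTm
  have hid : IsIdempotentElem (Matrix.toLinAlgEquiv' (1 - P)) := by
    rw [IsIdempotentElem, ← map_mul, sub_mul, one_mul, hP1, sub_zero]
  obtain ⟨n, -, hn⟩ := exists_trace_eq_natCast_of_isIdempotentElem hid
  refine ⟨c, n, ?_⟩
  have h1 := hc 1
  have h2 : ∀ A : Matrix X X K, LinearMap.trace K (X → K) (Matrix.toLinAlgEquiv' A) = A.trace :=
    fun A => Matrix.trace_toLin'_eq A
  rw [pow_one, h2, Matrix.trace_add] at h1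
  rw [h2] at hn
  simp only [mul_one] at h1
  rw [← h1, hn, add_sub_cancel_right]
  exact Finset.sum_congr rfl fun x _ => (hPQ x x).symm

end Cyclic

section Walks

variable {R ι : Type*} [Ring R] [Fintype ι] [DecidableEq ι]

/-- The entries of a power of a matrix, as sums over walks. -/
theorem matrix_pow_apply_eq_sum_ofFn (M : Matrix ι ι R) (m : ℕ) (i j : ι) :
    (M ^ (m + 1)) i j = ∑ I : Fin m → ι,
      (List.ofFn fun k => M ((Fin.cons i I : Fin (m + 1) → ι) k)
        ((Fin.snoc I j : Fin (m + 1) → ι) k)).prod := by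
  induction m generalizing i with
  | zero =>
    rw [Fintype.sum_unique]
    simp [List.ofFn_succ, Fin.snoc]
  | succ m ih =>
    rw [pow_succ', Matrix.mul_apply, ← (Fin.consEquiv fun _ => ι).sum_comp,
      Fintype.sum_prod_type]
    refine Finset.sum_congr rfl fun k _ => ?_
    rw [ih, Finset.mul_sum]
    refine Finset.sum_congr rfl fun I _ => ?_
    have h1 : (Fin.consEquiv (fun _ : Fin (m + 1) => ι)) (k, I) = Fin.cons k I := rfl
    rw [h1, ← Fin.cons_snoc_eq_snoc_cons]
    conv_rhs => rw [List.ofFn_succ]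
    simp

theorem trace_pow_eq_sum_ofFn (M : Matrix ι ι R) (m : ℕ) :
    (M ^ (m + 1)).trace = ∑ I : Fin (m + 1) → ι,
      (List.ofFn fun k => M (I k) (I (k + 1))).prod := by
  rw [← (Fin.consEquiv fun _ => ι).sum_comp, Fintype.sum_prod_type]
  refine Finset.sum_congr rfl fun i _ => ?_
  rw [Matrix.diag_apply, matrix_pow_apply_eq_sum_ofFn]
  refine Finset.sum_congr rfl fun I _ => ?_
  congr 2
  funext k
  have h1 : (Fin.consEquiv (fun _ : Fin (m + 1) => ι)) (i, I) = Fin.cons i I := rfl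
  rw [h1]
  congr 1
  refine Fin.lastCases ?_ (fun k => ?_) k
  · simp
  · simp [Fin.coeSucc_eq_succ]

end Walks

section FirstFormula

variable {K H : Type*} [Field K] [Ring H] [HopfAlgebra K H]

theorem sum_ofFn_mul {ι : Type*} [Fintype ι] {F : ι → ι → WithConv (H →ₗ[K] K)}
    (hF : ∀ i j (x y : H), (F i j).ofConv (x * y) = ∑ k, (F i k).ofConv x * (F k j).ofConv y)
    {m : ℕ} (I J : Fin m → ι) (x y : H) :
    (List.ofFn fun k => F (I k) (J k)).prod.ofConv (x * y) =
      ∑ L : Fin m → ι, (List.ofFn fun k => F (I k) (L k)).prod.ofConv x *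
        (List.ofFn fun k => F (L k) (J k)).prod.ofConv y := by
  induction m generalizing x y with
  | zero => simp
  | succ m ih =>
    rw [← (Fin.consEquiv fun _ => ι).sum_comp, Fintype.sum_prod_type]
    simp only [List.ofFn_succ, List.prod_cons, Fin.consEquiv_apply, Fin.cons_zero, Fin.cons_succ]
    have hdef : ∀ (f g : WithConv (H →ₗ[K] K)) (z : H), (f * g).ofConv z =
        LinearMap.mul' K K (TensorProduct.map f.ofConv g.ofConv (comul z)) := fun f g z => rfl
    simp only [hdef, Bialgebra.comul_mul]
    generalize comul (R := K) x = s
    generalize comul (R := K) y = t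
    induction s using TensorProduct.induction_on with
    | zero => simp
    | add s s' hs hs' => simp only [add_mul, map_add, Finset.sum_add_distrib, hs, hs']
    | tmul a b =>
      induction t using TensorProduct.induction_on with
      | zero => simp
      | add t t' ht ht' => simp only [mul_add, map_add, Finset.sum_add_distrib, ht, ht']
      | tmul a' b' =>
        simp only [Algebra.TensorProduct.tmul_mul_tmul, TensorProduct.map_tmul,
          LinearMap.mul'_apply, hF, ih, Finset.sum_mul_sum]
        refine Finset.sum_congr rfl fun k _ => Finset.sum_congr rfl fun L _ => ?_
        ring

/-- The rotation of the indices of a tensor of length `m + 1`. -/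
def rotateIndex (ι : Type*) (m : ℕ) : Equiv.Perm (Fin (m + 1) → ι) :=
  (Equiv.addRight (1 : Fin (m + 1))).symm.arrowCongr (Equiv.refl ι)

theorem rotateIndex_apply {ι : Type*} {m : ℕ} (I : Fin (m + 1) → ι) (k : Fin (m + 1)) :
    rotateIndex ι m I k = I (k + 1) := rfl

theorem rotateIndex_pow (ι : Type*) (m : ℕ) : rotateIndex ι m ^ (m + 1) = 1 := by
  have h : ∀ (n : ℕ) (I : Fin (m + 1) → ι) (k : Fin (m + 1)),
      (rotateIndex ι m ^ n) I k = I (k + n • (1 : Fin (m + 1))) := by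
    intro n
    induction n with
    | zero => simp
    | succ n ih =>
      intro I k
      rw [pow_succ, Equiv.Perm.mul_apply, ih, rotateIndex_apply, succ_nsmul, add_assoc]
  ext I k
  have h1 : (m + 1) • (1 : Fin (m + 1)) = 0 := by
    simpa using card_nsmul_eq_zero (x := (1 : Fin (m + 1)))
  rw [h, h1, add_zero, Equiv.Perm.one_apply]

theorem prod_ofFn_rotate_apply {φ : WithConv (H →ₗ[K] K) → K}
    (hφ : ∀ f g, φ (f * g) = φ (g * f)) {m : ℕ} (F : Fin (m + 1) → WithConv (H →ₗ[K] K)) :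
    φ (List.ofFn fun k => F (k + 1)).prod = φ (List.ofFn F).prod := by
  rw [List.ofFn_succ', List.ofFn_succ, List.concat_eq_append, List.prod_append, hφ]
  simp [Fin.coeSucc_eq_succ]

end FirstFormula

section FirstFormula

variable {K H V : Type*} [Field K] [IsAlgClosed K] [CharZero K] [Ring H] [HopfAlgebra K H]
  [IsSemisimpleRing H] [AddCommGroup V] [Module K V] [Module H V] [IsScalarTower K H V]
  [FiniteDimensional K V] {Λ : H}

/-- The value `χ(Λ^{[m]})` is the trace of the cyclic rotation on the invariants of `V^{⊗m}`, and
therefore a sum of `m`-th roots of unity. The invariants are the range of the idempotent by which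
`Λ` acts; the rotation preserves them because `Λ` is cocommutative. -/
theorem exists_character_sweedlerPower_eq (hΛ : IsNormalizedIntegral K Λ) {m : ℕ} (hm : 0 < m)
    {ζ : K} (hζ : IsPrimitiveRoot ζ m) :
    ∃ (c : ℕ → ℕ) (n : ℕ), character K H V (sweedlerPower K m Λ) =
      ∑ j ∈ Finset.range m, (c j : K) * ζ ^ j - n := by
  obtain ⟨m, rfl⟩ : ∃ k, m = k + 1 := ⟨m - 1, by omega⟩
  let b := Module.finBasis K V
  let M := coeffMatrix H b
  let P : Matrix (Fin (m + 1) → Fin (Module.finrank K V)) (Fin (m + 1) → Fin (Module.finrank K V))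
      K := Matrix.of fun I J => (List.ofFn fun k => M (I k) (J k)).prod.ofConv Λ
  have hΛΛ : Λ * Λ = Λ := by rw [hΛ.mul_left, hΛ.counit_eq, one_smul]
  have hP : P * P = P := by
    ext I J
    rw [Matrix.mul_apply]
    have h1 := sum_ofFn_mul (F := M) (fun i j x y => matrixCoeff_mul b i j x y) I J Λ Λ
    rw [hΛΛ] at h1
    exact h1.symm
  have hrot : ∀ I J, P (rotateIndex _ m I) (rotateIndex _ m J) = P I J := fun I J =>
    prod_ofFn_rotate_apply (φ := fun f => f.ofConv Λ)
      (fun f g => hΛ.conv_comm_apply f.ofConv g.ofConv) fun k => M (I k) (J k)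
  obtain ⟨c, n, hc⟩ := exists_sum_apply_perm_eq hP hrot hm (rotateIndex_pow _ m) hζ
  refine ⟨c, n, ?_⟩
  rw [← hc, character_eq_sum b]
  have h1 := congrArg (fun f => f.ofConv Λ) (trace_pow_eq_sum_ofFn M m)
  simp only [Matrix.trace, Matrix.diag_apply, ofConv_sum, LinearMap.sum_apply] at h1
  simp only [← coeffMatrix_pow_apply]
  exact h1

end FirstFormula

/-! ### Exponents and integrality -/

section Exponent

theorem exponent_spec {K H V : Type*} [Field K] [Ring H] [HopfAlgebra K H] [AddCommGroup V]
    [Module K V] [Module H V] [IsScalarTower K H V] {d : ℕ}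
    (hd : exponent K H V = (d : ℕ∞)) :
    0 < d ∧ ∀ (h : H) (v : V), sweedlerPower K d h • v = (counit h : K) • v := by
  rw [exponent] at hd
  have hne := csInf_mem (s := {n : ℕ∞ | ∃ m : ℕ, n = m ∧ 0 < m ∧
    ∀ (h : H) (v : V), sweedlerPower K m h • v = (Coalgebra.counit h : K) • v}) (by
      by_contra hempty
      rw [Set.not_nonempty_iff_eq_empty] at hempty
      rw [hempty, sInf_empty] at hd
      exact ENat.top_ne_natCast d hd)
  rw [hd] at hne
  obtain ⟨m, hm, hm0, h⟩ := hne
  have : d = m := by exact_mod_cast hm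
  subst this
  exact ⟨hm0, h⟩

theorem IsLargeComparedTo.coprime_div_gcd {m d : ℕ} (hd : 0 < d) (h : IsLargeComparedTo m d) :
    m.Coprime (d / m.gcd d) := by
  rw [Nat.coprime_iff_gcd_eq_one]
  by_contra hne
  obtain ⟨p, hp, hpdvd⟩ := Nat.exists_prime_and_dvd hne
  have hpm : p ∣ m := hpdvd.trans (Nat.gcd_dvd_left _ _)
  have hpq : p ∣ d / m.gcd d := hpdvd.trans (Nat.gcd_dvd_right _ _)
  obtain ⟨k, q, hq, hdk⟩ := Nat.exists_eq_pow_mul_and_not_dvd hd.ne' p hp.ne_one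
  have hpd : p ∣ d := hpq.trans (Nat.div_dvd_of_dvd (Nat.gcd_dvd_right _ _))
  have hkm := h p hp hpd hpm k q hdk hq
  have hkg : p ^ k ∣ m.gcd d := Nat.dvd_gcd hkm (hdk ▸ dvd_mul_right _ _)
  have h1 : p ^ k * p ∣ d := by
    have := mul_dvd_mul hkg hpq
    rwa [Nat.mul_div_cancel' (Nat.gcd_dvd_right _ _)] at this
  rw [hdk] at h1
  exact hq ((Nat.mul_dvd_mul_iff_left (pow_pos hp.pos k)).1 h1)

theorem isLargeComparedTo_of_squarefree {m d : ℕ} (hd : Squarefree d) :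
    IsLargeComparedTo m d := by
  intro p hp _ hpm k q hdk _
  have hk : k ≤ 1 := by
    by_contra hk
    have h1 : p * p ∣ d := by
      rw [hdk, ← sq]
      exact (pow_dvd_pow p (by omega)).trans (dvd_mul_right _ _)
    exact hp.one_lt.ne' (Nat.isUnit_iff.1 (hd p h1))
  exact (pow_dvd_pow p hk).trans (by rwa [pow_one])

theorem exists_int_frobeniusSchurIndicator {K H V : Type*} [Field K] [IsAlgClosed K] [CharZero K]
    [Ring H] [HopfAlgebra K H] [IsSemisimpleRing H] [AddCommGroup V] [Module K V] [Module H V]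
    [IsScalarTower K H V] [FiniteDimensional K V] {d : ℕ} (hd : exponent K H V = (d : ℕ∞)) {m : ℕ}
    (hm : 0 < m) (hmd : IsLargeComparedTo m d) :
    ∃ z : ℤ, frobeniusSchurIndicator m (character K H V) = (z : K) := by
  obtain ⟨hd0, hspec⟩ := exponent_spec hd
  have hΛ := normalizedIntegral_spec K H
  set q := d / m.gcd d with hq
  have hgd : m.gcd d ∣ d := Nat.gcd_dvd_right _ _
  have hq0 : 0 < q := Nat.div_pos (Nat.le_of_dvd hd0 hgd) (Nat.gcd_pos_of_pos_left _ hm)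
  have hdmq : d ∣ m * q := by
    rw [← Nat.mul_div_cancel' hgd]
    exact mul_dvd_mul (Nat.gcd_dvd_left _ _) dvd_rfl
  have hcop : m.Coprime q := hmd.coprime_div_gcd hd0
  have hmq0 : 0 < m * q := Nat.mul_pos hm hq0
  have : NeZero ((m * q : ℕ) : K) := ⟨Nat.cast_ne_zero.2 hmq0.ne'⟩
  obtain ⟨ζ, hζ⟩ := HasEnoughRootsOfUnity.exists_primitiveRoot K (m * q)
  have h1 : IsPrimitiveRoot (ζ ^ q) m := hζ.pow hmq0 (mul_comm m q)
  have h2 : IsPrimitiveRoot (ζ ^ m) q := hζ.pow hmq0 rfl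
  obtain ⟨c, n, hc⟩ := exists_character_sweedlerPower_eq (V := V) hΛ hm h1
  have hmem := character_sweedlerPower_mem_adjoin (V := V) hΛ hspec hq0 hdmq h2
  refine exists_int_eq_of_isIntegral_of_mem_bot (K := K) ?_ ?_
  · rw [frobeniusSchurIndicator, hc]
    exact (isIntegral_sum_natCast_mul_pow hm h1 c).sub (isIntegral_natCast n)
  · rw [← adjoin_inf_adjoin_eq_bot hm hq0 hcop hζ]
    refine ⟨?_, hmem⟩
    change character K H V (sweedlerPower K m (normalizedIntegral K H)) ∈ _
    rw [hc]
    exact sub_mem (sum_natCast_mul_pow_mem_adjoin m _ c) (natCast_mem _ n)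

end Exponent
end HopfFS

theorem mainTheorem3 {K : Type*} [Field K] [IsAlgClosed K] [CharZero K]
    {H : Type*} [Ring H] [HopfAlgebra K H] [IsSemisimpleRing H]
    {V : Type*} [AddCommGroup V] [Module K V] [Module H V] [IsScalarTower K H V]
    [FiniteDimensional K V] (d : ℕ) (hd : HopfFS.exponent K H V = (d : ℕ∞)) :
    (∀ m : ℕ, 0 < m → HopfFS.IsLargeComparedTo m d →
      ∃ z : ℤ, HopfFS.frobeniusSchurIndicator m (HopfFS.character K H V) = (z : K)) ∧
    (Squarefree d → ∀ m : ℕ, 0 < m →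
      ∃ z : ℤ, HopfFS.frobeniusSchurIndicator m (HopfFS.character K H V) = (z : K)) :=
  ⟨fun _ hm hmd => HopfFS.exists_int_frobeniusSchurIndicator hd hm hmd,
    fun hsq _ hm => HopfFS.exists_int_frobeniusSchurIndicator hd hm
      (HopfFS.isLargeComparedTo_of_squarefree hsq)⟩
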